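/- **Setting.** There are $k$ underlay blockchains, run in a partially synchronous network: the adversary chooses a global stabilization time $\mathrm{GST}$, and a message broadcast by an honest party at time $t$ reaches all honest validators of a chain by time $\max(\mathrm{GST},t)+\Delta$. A chain is *safe* if the ledgers output by any two clients at any two times are consistent (one is a prefix of the other) and the ledger of each client only grows; it is *live* if every message input to all its honest validators at time $t$ is in the ledgers of all clients at all times $\ge \max(\mathrm{GST},t)+T$, where $T$ is a known constant. The chains generate certificates of finality (certified ledgers of a safe chain never conflict) and proceed in epochs of fixed duration (block timestamps are nondecreasing, blocks and recorded snapshots from the future are not accepted, and on a live chain timestamps agree with real time up to the latency $T$). At every time every client (honest validators included) writes a certified snapshot of its view of all finalized underlay ledgers to all chains. An *overlay protocol* $\Pi$ is a rule by which a client computes an overlay ledger of transactions from its views of the finalized underlay ledgers up to the present time. It is safe if its ledgers satisfy the safety condition above; it is live if there is a constant $T'$, uniform over all runs considered, such that every transaction input at time $t$ to all honest validators of all underlay chains is in the overlay ledgers of all clients at all times $\ge\max(\mathrm{GST},t)+T'$. Let $V^S_\Pi$ (resp. $V^L_\Pi$) be the set of all $(s,l)\in\{0,1\}^k\times\{0,1\}^k$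 such that $\Pi$ is safe (resp. live) in all runs in which chain $i$ is safe whenever $s_i=1$ and chain $j$ is live whenever $l_j=1$. The protocol $\Pi$ is *characterized* by $(F^S,F^L)$, the sets of minimal elements of $V^S_\Pi$ and $V^L_\Pi$. A pair $(F^S,F^L)$ *dominates* $(E^S,E^L)$ if the upward closure of $E^S$ is contained in that of $F^S$, and the upward closure of $E^L$ in that of $F^L$. For $s\in\{0,1\}^k$ put $\mathrm{ind}(s)=\{i: s_i=1\}$. *Circuits* are the overlay protocols built from the underlay chains by two operations. In the *serial composition* of $A$ and $B$, certified snapshots of the ledger of $A$ are input to $B$, and the overlay ledger is obtained by concatenating the snapshots in the order of the ledger of $B$ and deleting duplicates. In the *triangular composition* of $A,B,C$, smart contracts on the three chains emulate the three validators of the leader-based omission-fault-tolerant protocol with epochs of fixed length $3D$ (the leader of the epoch proposes a block, validators that observed a proposal acknowledge it after time $D$, and those that have seen no certificate of two acknowledgements after time $2D$ send a leader-down message with the last block that they acknowledged; a leader needs a certificate or two leader-down messages of the previous epoch to propose), and clients output the blocks committed by at least two of the emulated validators. The client of a circuit never retracts what it has output. **Theorem.** Let $E^S,E^L\subseteq\{0,1\}^k\times\{0,1\}^k$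 be such that 1. for all $(s,l)\in E^L$ and $(s',l')\in E^S$, $s=l'=0^k$; 2. for all $(0^k,l^1),(0^k,l^2)\in E^L$ and $(s,0^k)\in E^S$, $\mathrm{ind}(l^1)\cap\mathrm{ind}(l^2)\cap\mathrm{ind}(s)\ne\emptyset$; and, to exclude a degenerate case, such that $E^S\neq\emptyset$ or $l\ne 0^k$ for all $(s,l)\in E^L$. Then for all $\Delta$ and $T$ there is an overlay protocol that is characterized, under partial synchrony, by a pair dominating $(E^S,E^L)$. If $E^S$ and $E^L$ are both non-empty, then this protocol can be taken to be a circuit, i.e. to be built from serial and triangular compositions. -/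

import Mathlib

namespace Interchain

/-! ## Ledgers and sanitization -/

/-- Two ledgers are consistent if one of them is a prefix of the other. -/
def Consistent {α : Type} (L L' : List α) : Prop := L <+: L' ∨ L' <+: L

open Classical in
/-- The sanitization function: concatenate the two ledgers and eliminate the duplicates,
keeping the first occurrence. -/
noncomputable def clean {α : Type} (A B : List α) : List α :=
  B.foldl (fun acc x => if x ∈ acc then acc else acc ++ [x]) A

/-- Iterated sanitization of a sequence of ledgers, in the given order. -/
noncomputable def sanitize {α : Type} (Ls : List (List α)) : List α := Ls.foldl clean []

/-! ## Underlay chains under partial synchrony -/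

/-- A message recorded on one of the `k` underlay chains: a transaction of the environment,
a snapshot of the (certified) ledgers of all underlay chains as read by somebody, or a marker
for an empty block. A message that claims to be a snapshot but comes without valid
certificates is not parsed as a `snapshot` (see `Trace.Admissible.snapshot_certified`). -/
inductive Msg (k : ℕ) (Tx : Type) : Type
  | tx (x : Tx)
  | snapshot (W : Fin k → List (ℕ × Msg k Tx))
  | empty

/-- The ledger of an underlay chain: the sequence of its messages, each with the timestamp
(number of the epoch) of the block that contains it. -/
abbrev Ledger (k : ℕ) (Tx : Type) : Type := List (ℕ × Msg k Tx)

/-- A view: one finalized ledger for each underlay chain. -/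
abbrev View (k : ℕ) (Tx : Type) : Type := Fin k → Ledger k Tx

/-- What happens in one run of `k` underlay chains. -/
structure Trace (k : ℕ) (Tx : Type) where
  /-- The clients of the chains. Every honest validator runs a client of every chain and is
  counted here. -/
  Client : Type
  /-- The global stabilization time. -/
  GST : ℕ
  /-- The ledger of chain `i` output by client `c` at time `t`. -/
  ledger : Fin k → Client → ℕ → Ledger k Tx
  /-- The ledgers of chain `i` for which a certificate of finality is ever produced. -/
  certified : Fin k → Set (Ledger k Tx)
  /-- The messages that are input to all honest validators of chain `i` at time `t`. -/
  received : Fin k → ℕ → Set (Msg k Tx)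

namespace Trace

variable {k : ℕ} {Tx : Type}

/-- The view of client `c` at time `t`. -/
def view (R : Trace k Tx) (c : R.Client) (t : ℕ) : View k Tx := fun i => R.ledger i c t

/-- Chain `i` is safe. -/
def SafeChain (R : Trace k Tx) (i : Fin k) : Prop :=
  (∀ c c' t t', Consistent (R.ledger i c t) (R.ledger i c' t')) ∧
    ∀ c t t', t ≤ t' → R.ledger i c t <+: R.ledger i c t'

/-- Chain `i` is live with latency `T` after GST. -/
def LiveChain (R : Trace k Tx) (T : ℕ) (i : Fin k) : Prop :=
  ∀ t, ∀ m ∈ R.received i t, ∀ c t', max R.GST t + T ≤ t' → ∃ e ∈ R.ledger i c t', e.2 = m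

/-- The runs that can occur in a partially synchronous network with delay bound `Δ` after GST,
on underlay chains that generate certificates and proceed in epochs of fixed duration, `T`
being the latency of the live chains. Nothing else is assumed about chains that are
not safe or not live. -/
structure Admissible (R : Trace k Tx) (Δ T : ℕ) : Prop where
  /-- Clients only output certified ledgers. -/
  ledger_certified : ∀ i c t, R.ledger i c t ∈ R.certified i
  /-- Clients, whose clocks are synchronized, do not accept blocks from the future. -/
  not_future : ∀ i c t, ∀ e ∈ R.ledger i c t, e.1 ≤ t
  /-- Timestamps do not decrease along a ledger. -/
  timestamps_sorted : ∀ i, ∀ L ∈ R.certified i, L.Pairwise (fun e e' => e.1 ≤ e'.1)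
  /-- Cross-chain reads are verified: a snapshot recorded on a chain consists of certified
  ledgers. -/
  snapshot_certified : ∀ i, ∀ L ∈ R.certified i, ∀ τ W, (τ, Msg.snapshot W) ∈ L →
    ∀ j, W j ∈ R.certified j
  /-- A block contains no snapshot with blocks of a later time than its own. -/
  snapshot_past : ∀ i, ∀ L ∈ R.certified i, ∀ τ W, (τ, Msg.snapshot W) ∈ L →
    ∀ j, ∀ e ∈ W j, e.1 ≤ τ
  /-- The chains generate certificates: if a chain is safe, then no two conflicting ledgers of
  it are ever certified. -/
  generates_certificates : ∀ i, R.SafeChain i →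
    ∀ L ∈ R.certified i, ∀ L' ∈ R.certified i, Consistent L L'
  /-- The chains proceed in epochs of fixed duration: the blocks of a live chain follow the real
  time up to the latency. -/
  epochs_progress : ∀ i, R.LiveChain T i → ∀ c t, R.GST + T ≤ t →
    ∃ e ∈ R.ledger i c t, t ≤ e.1 + T
  /-- The chains proceed in epochs of fixed duration: on a live chain, the block that contains a
  message carries a timestamp within the latency. -/
  epochs_timely : ∀ i, R.LiveChain T i → ∀ t, ∀ m ∈ R.received i t,
    ∀ c t', max R.GST t + T ≤ t' → ∃ e ∈ R.ledger i c t', e.2 = m ∧ e.1 ≤ max R.GST t + T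
  /-- Cross-chain communication: at every time, every client broadcasts a snapshot of its
  view to the validators of all chains; the network delivers it within `Δ` after GST. -/
  relay : ∀ c t i, ∃ s, t ≤ s ∧ s ≤ max R.GST t + Δ ∧ Msg.snapshot (R.view c t) ∈ R.received i s

end Trace

/-! ## Overlay protocols and their security -/

/-- An overlay protocol: the rule by which a client computes the overlay ledger from its views
of the finalized underlay ledgers up to now. (What is written to the underlay chains is the full
information that participants have, namely their views, so that only this rule is left to be
chosen.) -/
abbrev Overlay (k : ℕ) (Tx : Type) : Type := List (View k Tx) → List Tx

namespace Trace

variable {k : ℕ} {Tx : Type}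

/-- The ledger of the overlay protocol `P` output by client `c` at time `t`. -/
def overlayLedger (R : Trace k Tx) (P : Overlay k Tx) (c : R.Client) (t : ℕ) : List Tx :=
  P ((List.range (t + 1)).map (R.view c))

/-- The overlay protocol is safe in this run. -/
def OverlaySafe (R : Trace k Tx) (P : Overlay k Tx) : Prop :=
  (∀ c c' t t', Consistent (R.overlayLedger P c t) (R.overlayLedger P c' t')) ∧
    ∀ c t t', t ≤ t' → R.overlayLedger P c t <+: R.overlayLedger P c t'

/-- The overlay protocol is live with latency `T'` after GST in this run. -/
def OverlayLive (R : Trace k Tx) (P : Overlay k Tx) (T' : ℕ) : Prop :=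
  ∀ x t, (∀ i, Msg.tx x ∈ R.received i t) →
    ∀ c t', max R.GST t + T' ≤ t' → x ∈ R.overlayLedger P c t'

end Trace

/-- A pair `(s, l)`: the chains that are guaranteed to be safe, and those that are guaranteed to
be live. -/
abbrev Guarantee (k : ℕ) : Type := (Fin k → Bool) × (Fin k → Bool)

/-- `ind s = {i : s_i = 1}`. -/
def ind {k : ℕ} (s : Fin k → Bool) : Set (Fin k) := {i | s i = true}

/-- The chains provide at least the guarantees `v`. -/
def Trace.Meets {k : ℕ} {Tx : Type} (R : Trace k Tx) (T : ℕ) (v : Guarantee k) : Prop :=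
  (∀ i ∈ ind v.1, R.SafeChain i) ∧ ∀ i ∈ ind v.2, R.LiveChain T i

/-- `V^S`: the guarantees under which the overlay protocol is safe. -/
def safetySet {k : ℕ} {Tx : Type} (Δ T : ℕ) (P : Overlay k Tx) : Set (Guarantee k) :=
  {v | ∀ R : Trace k Tx, R.Admissible Δ T → R.Meets T v → R.OverlaySafe P}

/-- `V^L`: the guarantees under which the overlay protocol is live with constant latency. -/
def livenessSet {k : ℕ} {Tx : Type} (Δ T : ℕ) (P : Overlay k Tx) : Set (Guarantee k) :=
  {v | ∃ T', ∀ R : Trace k Tx, R.Admissible Δ T → R.Meets T v → R.OverlayLive P T'}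

/-- The extreme elements of `V`. -/
def exm {k : ℕ} (V : Set (Guarantee k)) : Set (Guarantee k) := {v | v ∈ V ∧ ¬∃ w ∈ V, w < v}

/-- The overlay protocol is characterized by `(FS, FL)`. -/
def CharacterizedBy {k : ℕ} {Tx : Type} (Δ T : ℕ) (P : Overlay k Tx)
    (FS FL : Set (Guarantee k)) : Prop :=
  FS = exm (safetySet Δ T P) ∧ FL = exm (livenessSet Δ T P)

/-- `(FS, FL)` dominates `(ES, EL)`: inclusion of the upward closed sets described by them. -/
def Dominates {k : ℕ} (FS FL ES EL : Set (Guarantee k)) : Prop :=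
  (upperClosure ES : Set (Guarantee k)) ⊆ upperClosure FS ∧
    (upperClosure EL : Set (Guarantee k)) ⊆ upperClosure FL

/-! ## The omission-fault tolerant protocol run by three emulated validators -/

/-- The ledger that a composed protocol outputs for payloads in `X`: a sequence of entries, each
with a timestamp; `none` only shows the passing of time. -/
abbrev Feed (X : Type) : Type := List (ℕ × Option X)

namespace OFT

/-- The ledger of a chain whose smart contract emulates a validator. An entry can carry an input
from outside (in `X`) and a certified view (in `V`) of the three chains. -/
abbrev VFeed (V X : Type) : Type := Feed (Option X × Option V)

/-- A block is given by the chain that it defines: the epoch and the data of each block after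
the genesis block `[]`. A block extends another one iff the latter is a prefix. -/
abbrev Block (X : Type) : Type := List (ℕ × List X)

/-- The epoch of a block, which is `0` for the genesis block. -/
def Block.epoch {X : Type} (b : Block X) : ℕ := (b.getLast?.map Prod.fst).getD 0

variable {V X : Type}

/-- The contract with this ledger has reached time `n * D`. -/
def Reached (D n : ℕ) (L : VFeed V X) : Prop := ∃ e ∈ L, n * D ≤ e.1

/-- The part of the ledger executed before time `n * D`. -/
def before (D n : ℕ) (L : VFeed V X) : VFeed V X := L.takeWhile (fun e => decide (e.1 < n * D))

/-- `Knows G j L i M`: who executes the ledger `L` of validator `j` observes the execution of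
the ledger `M` by validator `i`, being `L` itself or contained in certified views recorded in
`L`; here `G i W` is the ledger of validator `i` in the view `W`. -/
inductive Knows (G : Fin 3 → V → VFeed V X) : Fin 3 → VFeed V X → Fin 3 → VFeed V X → Prop
  | self (j : Fin 3) (L : VFeed V X) : Knows G j L j L
  | read (j : Fin 3) (L : VFeed V X) (τ : ℕ) (x : Option X) (W : V) (i' i : Fin 3)
      (M : VFeed V X) : (τ, some (x, some W)) ∈ L → Knows G i' (G i' W) i M → Knows G j L i M

/-- What matters of an epoch `v` in later epochs. -/
structure Epoch (V X : Type) where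
  /-- An epoch `v` certificate of this block is observed in this ledger of this validator. -/
  Cert : Fin 3 → VFeed V X → Block X → Prop
  /-- The validator sends a leader-down message for epoch `v`. -/
  Down : Fin 3 → VFeed V X → Prop
  /-- The block of maximal epoch, among the epochs up to `v`, that the validator acknowledged;
  it is carried by the leader-down message. -/
  high : Fin 3 → VFeed V X → Block X

/-- Two different validators sent leader-down messages that are observed in `P`. -/
def TwoDowns (G : Fin 3 → V → VFeed V X) (S : Epoch V X) (j : Fin 3) (P : VFeed V X) : Prop :=
  ∃ i₁ i₂ M₁ M₂, i₁ ≠ i₂ ∧ Knows G j P i₁ M₁ ∧ S.Down i₁ M₁ ∧ Knows G j P i₂ M₂ ∧ S.Down i₂ M₂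

/-- `b` has maximal epoch among the blocks in the leader-down messages observed in `P`. -/
def MaxDown (G : Fin 3 → V → VFeed V X) (S : Epoch V X) (j : Fin 3) (P : VFeed V X)
    (b : Block X) : Prop :=
  (∃ i M, Knows G j P i M ∧ S.Down i M ∧ S.high i M = b) ∧
    ∀ i M, Knows G j P i M → S.Down i M → Block.epoch (S.high i M) ≤ Block.epoch b

open Classical in
/-- The block on which the leader of the next epoch builds, if it has a ticket: a block with a
certificate or else the maximal one in the leader-down messages. -/
noncomputable def parent (G : Fin 3 → V → VFeed V X) (S : Epoch V X) (j : Fin 3)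
    (P : VFeed V X) : Option (Block X) :=
  if ∃ b, S.Cert j P b then some (Classical.epsilon fun b => S.Cert j P b)
  else if TwoDowns G S j P then some (Classical.epsilon fun b => MaxDown G S j P b)
  else none

/-- The inputs recorded in a ledger. -/
def inputs (P : VFeed V X) : List X := P.filterMap (fun e => e.2.bind Prod.fst)

open Classical in
/-- The inputs recorded in `P` that are not yet in the chain of `b`. -/
noncomputable def outstanding (b : Block X) (P : VFeed V X) : List X :=
  (clean [] (inputs P)).filter (fun x => decide (x ∉ b.flatMap Prod.snd))

/-- The round-robin leader of epoch `v`. -/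
def leader (v : ℕ) : Fin 3 := ⟨v % 3, Nat.mod_lt v (by decide)⟩

/-- At time `3 * D * v` the leader of epoch `v` proposes the block `b`; `S` describes epoch
`v - 1`. -/
def Proposes (G : Fin 3 → V → VFeed V X) (D : ℕ) (S : Epoch V X) (v : ℕ) (L : VFeed V X)
    (b : Block X) : Prop :=
  Reached D (3 * v) L ∧ ∃ b₀, parent G S (leader v) (before D (3 * v) L) = some b₀ ∧
    b = b₀ ++ [(v, outstanding b₀ (before D (3 * v) L))]

/-- At time `3 * D * v + D` validator `j` acknowledges a block of epoch `v` if it has observed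
the proposal of the leader. -/
def Acks (G : Fin 3 → V → VFeed V X) (D : ℕ) (S : Epoch V X) (v : ℕ) (j : Fin 3)
    (L : VFeed V X) (b : Block X) : Prop :=
  Reached D (3 * v + 1) L ∧
    ∃ M, Knows G j (before D (3 * v + 1) L) (leader v) M ∧ Proposes G D S v M b

/-- An epoch `v` certificate: acknowledgements by two different validators. -/
def Certifies (G : Fin 3 → V → VFeed V X) (D : ℕ) (S : Epoch V X) (v : ℕ) (j : Fin 3)
    (P : VFeed V X) (b : Block X) : Prop :=
  ∃ i₁ i₂ M₁ M₂, i₁ ≠ i₂ ∧ Knows G j P i₁ M₁ ∧ Acks G D S v i₁ M₁ b ∧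
    Knows G j P i₂ M₂ ∧ Acks G D S v i₂ M₂ b

open Classical in
/-- The execution of the protocol, epoch by epoch. The genesis block is certified at epoch `0`
for all validators. At time `3 * D * v + 2 * D`, a validator that has not observed a certificate
for epoch `v` sends a leader-down message. -/
noncomputable def epoch (G : Fin 3 → V → VFeed V X) (D : ℕ) : ℕ → Epoch V X
  | 0 => { Cert := fun _ _ b => b = [], Down := fun _ _ => False, high := fun _ _ => [] }
  | v + 1 =>
    { Cert := Certifies G D (epoch G D v) (v + 1)
      Down := fun j L => Reached D (3 * (v + 1) + 2) L ∧
        ¬∃ b, Certifies G D (epoch G D v) (v + 1) j (before D (3 * (v + 1) + 2) L) b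
      high := fun j L =>
        if ∃ b, Acks G D (epoch G D v) (v + 1) j L b then
          Classical.epsilon fun b => Acks G D (epoch G D v) (v + 1) j L b
        else (epoch G D v).high j L }

/-- A client with view `W` accepts a block that is committed by at least two emulated validators;
a validator commits a block when it observes an epoch `v` certificate for it, `v` being the epoch
of the block. -/
def Accepted (G : Fin 3 → V → VFeed V X) (D : ℕ) (W : V) (b : Block X) : Prop :=
  ∃ v i₁ i₂, i₁ ≠ i₂ ∧ ((epoch G D v).Cert i₁ (G i₁ W) b) ∧ ((epoch G D v).Cert i₂ (G i₂ W) b)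

/-- All accepted blocks, in the order of their epochs. -/
noncomputable def acceptedList (G : Fin 3 → V → VFeed V X) (D : ℕ) (W : V) : List (Block X) :=
  Classical.epsilon fun bs : List (Block X) =>
    (∀ b, b ∈ bs ↔ Accepted G D W b) ∧ bs.Pairwise (fun b b' => Block.epoch b ≤ Block.epoch b')

/-- The entries of a block and of its prefix chain. The timestamp is the starting time of the
epoch. -/
def Block.entries {X : Type} (D : ℕ) (b : Block X) : Feed X :=
  b.flatMap (fun p => (3 * D * p.1, none) :: p.2.map (fun x => (3 * D * p.1, some x)))

/-- The ledger output in view `W`: the accepted blocks and their prefix chains, sanitized. -/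
noncomputable def output (G : Fin 3 → V → VFeed V X) (D : ℕ) (W : V) : Feed X :=
  sanitize ((acceptedList G D W).map (Block.entries D))

end OFT

/-! ## Circuits -/

/-- Circuits built from the underlay chains by serial compositions and triangular compositions. A
triangular composition has the length `3 * D` of its epochs as a parameter. -/
inductive Circuit (k : ℕ) : Type
  | chain (i : Fin k)
  | serial (A B : Circuit k)
  | triangular (D : ℕ) (A B C : Circuit k)

/-- The view in a snapshot message. -/
def Msg.view? {k : ℕ} {Tx : Type} : Msg k Tx → Option (View k Tx)
  | .snapshot W => some W
  | _ => none

/-- `C.run X read W` is the ledger, in the view `W` of the underlay chains, of the protocol `C`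
when it is used to order payloads in `X`, where `read` extracts the payload from the messages on
the underlay chains.

* Serial composition: `A` orders the payloads, `B` orders the snapshots of the ledger of `A`; the
  ledger results from sanitizing the snapshots of the ledger of `A` in the order in which they
  appear in the ledger of `B`.
* Triangular composition: contracts on `A`, `B`, `C` emulate the three validators, whose inputs
  are the payloads and the cross-chain reads of the other chains. -/
noncomputable def Circuit.run {k : ℕ} {Tx : Type} :
    Circuit k → (X : Type) → (Msg k Tx → Option X) → View k Tx → Feed X
  | .chain i, _, read, W => (W i).map (fun e => (e.1, read e.2))
  | .serial A B, X, read, W =>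
    sanitize ((B.run (Feed X) (fun m => m.view?.map (A.run X read)) W).filterMap Prod.snd)
  | .triangular D A B C, X, read, W =>
    OFT.output (V := View k Tx) (X := X)
      ![A.run (Option X × Option (View k Tx)) (fun m => some (read m, m.view?)),
        B.run (Option X × Option (View k Tx)) (fun m => some (read m, m.view?)),
        C.run (Option X × Option (View k Tx)) (fun m => some (read m, m.view?))] D W

/-- The transaction in a message of the environment. -/
def Msg.tx? {k : ℕ} {Tx : Type} : Msg k Tx → Option Tx
  | .tx x => some x
  | _ => none

/-- The overlay protocol given by a circuit: the client outputs the transactions in the ledger of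
the circuit, never retracting what it has output before. -/
noncomputable def Circuit.overlay {k : ℕ} {Tx : Type} (C : Circuit k) : Overlay k Tx :=
  fun history => sanitize (history.map (fun W => (C.run Tx Msg.tx? W).filterMap Prod.snd))

end Interchain

namespace Interchain

/-! ## Prefixes, consistency and sanitization -/

section Lists

variable {α β : Type}

/-! It suffices to build one protocol that is safe under every guarantee in `ES` and live under
every guarantee in `EL`: guarantees form a finite order, so minimal elements below these always
exist (`upperClosure_subset_exm`).

Fix one safety guarantee `s`. For at most two liveness guarantees, the intersection hypothesis
yields a single chain that is safe under `s` and live under each of them. For three or more,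
omitting each of the first three in turn gives, by induction, three circuits. All three are safe
under `s`, which makes their triangular composition safe, and every liveness guarantee is served by
at least two of them, which makes it live (`exists_triangular_circuit`). The circuits for the
different `s` are then put in series: a serial composition is safe as soon as one component is, and
live if both are (`exists_circuit`).

Safety of the triangular composition is quorum intersection. Consistent ledgers prevent a leader
from equivocating, and among three validators two acknowledgements and two leader-down messages
share a sender, so later proposals extend every certified block (`OFT.prefix_of_certified`). For
liveness, the latency `K` of the emulated validators satisfies `2 * K < D`; every message between
two live ones therefore meets its deadline, and one of them leads in any two successive epochs
(`OFT.exists_accepted_soon`).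

The invariants are shaped by composition. They range over all payload types and readers, because a
composition runs its parts on other payloads. Safety concerns all certified views, because recorded
snapshots are certified even on unsafe chains. `Timely` also controls timestamps, because the
emulated validators use them as clocks. -/

theorem Consistent.symm {L L' : List α} (h : Consistent L L') : Consistent L' L := Or.symm h

theorem Consistent.refl (L : List α) : Consistent L L := Or.inl (List.prefix_refl L)

theorem consistent_nil (L : List α) : Consistent [] L := Or.inl List.nil_prefix

theorem Consistent.of_prefix {L L' M M' : List α} (h : Consistent L L') (hM : M <+: L)
    (hM' : M' <+: L') : Consistent M M' := by
  rcases h with h | h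
  · exact List.prefix_or_prefix_of_prefix (hM.trans h) hM'
  · exact List.prefix_or_prefix_of_prefix hM (hM'.trans h)

theorem Consistent.map {L L' : List α} (h : Consistent L L') (f : α → β) :
    Consistent (L.map f) (L'.map f) :=
  h.imp (fun h => h.map f) (fun h => h.map f)

theorem Consistent.filterMap {L L' : List α} (h : Consistent L L') (f : α → Option β) :
    Consistent (L.filterMap f) (L'.filterMap f) :=
  h.imp (fun h => h.filterMap f) (fun h => h.filterMap f)

theorem Consistent.flatMap {L L' : List α} (h : Consistent L L') (f : α → List β) :
    Consistent (L.flatMap f) (L'.flatMap f) :=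
  h.imp (fun h => h.flatMap f) (fun h => h.flatMap f)

@[simp] theorem clean_nil (A : List α) : clean A [] = A := rfl

open Classical in
theorem clean_cons (A B : List α) (x : α) :
    clean A (x :: B) = clean (if x ∈ A then A else A ++ [x]) B := rfl

theorem clean_append (A B C : List α) : clean A (B ++ C) = clean (clean A B) C := by
  simp only [clean, List.foldl_append]

theorem prefix_clean (A B : List α) : A <+: clean A B := by
  induction B generalizing A with
  | nil => exact List.prefix_refl A
  | cons x B ih =>
    rw [clean_cons]
    refine List.IsPrefix.trans ?_ (ih _)
    split_ifs
    · exact List.prefix_refl A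
    · exact List.prefix_append A [x]

theorem mem_clean {A B : List α} {x : α} : x ∈ clean A B ↔ x ∈ A ∨ x ∈ B := by
  induction B generalizing A with
  | nil => simp
  | cons y B ih =>
    rw [clean_cons, ih]
    split_ifs with h
    · constructor
      · rintro (h | h) <;> simp [h]
      · rintro (h' | h')
        · exact Or.inl h'
        · rcases List.mem_cons.1 h' with rfl | h'
          · exact Or.inl h
          · exact Or.inr h'
    · simp [or_assoc]

theorem clean_eq_self {A B : List α} (h : ∀ x ∈ B, x ∈ A) : clean A B = A := by
  induction B generalizing A with
  | nil => rfl
  | cons x B ih =>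
    rw [clean_cons, if_pos (h x (by simp))]
    exact ih fun y hy => h y (by simp [hy])

theorem clean_prefix {A B B' : List α} (h : B <+: B') : clean A B <+: clean A B' := by
  obtain ⟨C, rfl⟩ := h
  rw [clean_append]
  exact prefix_clean _ _

theorem Consistent.clean {L L' : List α} (h : Consistent L L') (A : List α) :
    Consistent (clean A L) (clean A L') :=
  h.imp clean_prefix clean_prefix

theorem sanitize_append_singleton (Ls : List (List α)) (B : List α) :
    sanitize (Ls ++ [B]) = clean (sanitize Ls) B := by
  simp [sanitize]

theorem sanitize_prefix {Ls Ls' : List (List α)} (h : Ls <+: Ls') :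
    sanitize Ls <+: sanitize Ls' := by
  obtain ⟨C, rfl⟩ := h
  induction C using List.reverseRecOn with
  | nil => simp
  | append_singleton C B ih =>
    rw [← List.append_assoc, sanitize_append_singleton]
    exact ih.trans (prefix_clean _ _)

theorem Consistent.sanitize {Ls Ls' : List (List α)} (h : Consistent Ls Ls') :
    Consistent (sanitize Ls) (sanitize Ls') :=
  h.imp sanitize_prefix sanitize_prefix

theorem mem_sanitize {Ls : List (List α)} {x : α} : x ∈ sanitize Ls ↔ ∃ L ∈ Ls, x ∈ L := by
  induction Ls using List.reverseRecOn with
  | nil => simp [sanitize]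
  | append_singleton Ls B ih =>
    rw [sanitize_append_singleton, mem_clean, ih]
    simp only [List.mem_append, List.mem_singleton]
    constructor
    · rintro (⟨L, hL, hx⟩ | hx)
      · exact ⟨L, Or.inl hL, hx⟩
      · exact ⟨B, Or.inr rfl, hx⟩
    · rintro ⟨L, hL | rfl, hx⟩
      · exact Or.inl ⟨L, hL, hx⟩
      · exact Or.inr hx

/-- Sanitizing pairwise consistent ledgers only removes the duplicates of one of them. -/
theorem sanitize_eq_clean {Ls : List (List α)}
    (h : ∀ L ∈ Ls, ∀ L' ∈ Ls, Consistent L L') :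
    ∃ L, (L ∈ Ls ∨ L = []) ∧ sanitize Ls = clean [] L := by
  induction Ls using List.reverseRecOn with
  | nil => exact ⟨[], Or.inr rfl, rfl⟩
  | append_singleton Ls B ih =>
    obtain ⟨L, hL, hs⟩ := ih fun L hL L' hL' => h L (by simp [hL]) L' (by simp [hL'])
    have hLB : Consistent L B := by
      rcases hL with hL | rfl
      · exact h L (by simp [hL]) B (by simp)
      · exact consistent_nil B
    rw [sanitize_append_singleton, hs]
    rcases hLB with ⟨C, rfl⟩ | hBL
    · refine ⟨L ++ C, Or.inl (by simp), ?_⟩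
      rw [clean_append, clean_append,
        clean_eq_self (A := clean [] L) fun x hx => mem_clean.2 (Or.inr hx)]
    · refine ⟨L, hL.imp (fun h => by simp [h]) id, ?_⟩
      exact clean_eq_self fun x hx => mem_clean.2 (Or.inr (hBL.subset hx))

/-- Ledgers obtained by sanitizing families of pairwise consistent ledgers are consistent. -/
theorem consistent_sanitize_of_forall {Ls Ls' : List (List α)} (p : List α → Prop)
    (hp : ∀ L L', p L → p L' → Consistent L L') (h : ∀ L ∈ Ls, p L) (h' : ∀ L ∈ Ls', p L) :
    Consistent (sanitize Ls) (sanitize Ls') := by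
  obtain ⟨L, hL, e⟩ := sanitize_eq_clean fun L hL L' hL' => hp L L' (h L hL) (h L' hL')
  obtain ⟨L', hL', e'⟩ := sanitize_eq_clean fun L hL L' hL' => hp L L' (h' L hL) (h' L' hL')
  rw [e, e']
  refine Consistent.clean ?_ []
  rcases hL with hL | rfl
  · rcases hL' with hL' | rfl
    · exact hp L L' (h L hL) (h' L' hL')
    · exact (consistent_nil L).symm
  · exact consistent_nil L'

/-- Membership in `takeWhile` of a timestamp bound is how timeliness is expressed: no later
timestamp precedes the entry. It is established by exhibiting an initial segment that obeys the
bound. -/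
theorem mem_takeWhile_of_prefix {p : α → Bool} {P L : List α} (h : P <+: L)
    (hp : ∀ x ∈ P, p x = true) {x : α} (hx : x ∈ P) : x ∈ L.takeWhile p := by
  obtain ⟨C, rfl⟩ := h
  rw [List.takeWhile_append_of_pos hp]
  exact List.mem_append_left _ hx

theorem mem_takeWhile_mono {p q : α → Bool} (hpq : ∀ x, p x = true → q x = true) {L : List α}
    {x : α} (hx : x ∈ L.takeWhile p) : x ∈ L.takeWhile q :=
  mem_takeWhile_of_prefix (List.takeWhile_prefix p)
    (fun _ hy => hpq _ (List.mem_takeWhile_imp hy)) hx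

theorem takeWhile_eq_of_prefix {p : α → Bool} {L L' : List α} (h : L <+: L')
    (hp : ∃ x ∈ L, p x = false) : L'.takeWhile p = L.takeWhile p := by
  obtain ⟨C, rfl⟩ := h
  induction L with
  | nil => simp at hp
  | cons y L ih =>
    simp only [List.cons_append, List.takeWhile_cons]
    split
    · next hy =>
      rw [ih]
      obtain ⟨x, hx, hpx⟩ := hp
      rcases List.mem_cons.1 hx with rfl | hx
      · simp [hy] at hpx
      · exact ⟨x, hx, hpx⟩
    · rfl

/-- A finite set can be listed in nondecreasing order of a given rank. -/
theorem exists_sorted_list {S : Set α} (hS : S.Finite) (rank : α → ℕ) :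
    ∃ l : List α, (∀ b, b ∈ l ↔ b ∈ S) ∧ l.Pairwise (fun b b' => rank b ≤ rank b') := by
  classical
  have : Std.Total fun b b' : α => rank b ≤ rank b' := ⟨fun a b => le_total _ _⟩
  have : IsTrans α fun b b' : α => rank b ≤ rank b' := ⟨fun _ _ _ => le_trans⟩
  refine ⟨List.insertionSort (fun b b' => rank b ≤ rank b') hS.toFinset.toList, fun b => ?_,
    List.pairwise_insertionSort _ _⟩
  rw [List.mem_insertionSort]
  simp

end Lists

/-! ## The omission-fault tolerant protocol -/

namespace OFT

/-! ### Stability of the protocol's actions, and the epochs and data of blocks. -/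

section Basic

variable {V X : Type} {G : Fin 3 → V → VFeed V X} {D : ℕ}

theorem Reached.mono {n : ℕ} {L L' : VFeed V X} (h : Reached D n L) (hL : L <+: L') :
    Reached D n L' := by
  obtain ⟨e, he, hn⟩ := h
  exact ⟨e, hL.subset he, hn⟩

theorem Reached.of_le {n m : ℕ} {L : VFeed V X} (h : Reached D n L) (hm : m ≤ n) :
    Reached D m L := by
  obtain ⟨e, he, hn⟩ := h
  exact ⟨e, he, (Nat.mul_le_mul_right D hm).trans hn⟩

theorem before_prefix (n : ℕ) (L : VFeed V X) : before D n L <+: L := List.takeWhile_prefix _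

/-- Once a deadline has passed, what was executed before it is frozen. Actions that depend only on
this part are therefore never revised when the ledger grows. -/
theorem before_eq_of_prefix {n : ℕ} {L L' : VFeed V X} (h : Reached D n L) (hL : L <+: L') :
    before D n L' = before D n L := by
  obtain ⟨e, he, hn⟩ := h
  exact takeWhile_eq_of_prefix hL ⟨e, he, by simpa using hn⟩

theorem before_eq_of_consistent {n : ℕ} {L L' : VFeed V X} (h : Reached D n L)
    (h' : Reached D n L') (hL : Consistent L L') : before D n L = before D n L' :=
  hL.elim (fun hL => (before_eq_of_prefix h hL).symm) (fun hL => before_eq_of_prefix h' hL)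

/-- The observed ledger may grow because the observer's own ledger does; ledgers read from recorded
views stay the same. -/
theorem Knows.mono {j i : Fin 3} {P L M : VFeed V X} (h : Knows G j P i M) (hP : P <+: L) :
    ∃ M', M <+: M' ∧ Knows G j L i M' := by
  cases h with
  | self => exact ⟨L, hP, .self j L⟩
  | read _ _ τ x W i' _ _ he hk =>
    exact ⟨M, List.prefix_refl M, .read _ _ τ x W i' _ _ (hP.subset he) hk⟩

theorem Proposes.mono {S : Epoch V X} {v : ℕ} {L L' : VFeed V X} {b : Block X}
    (h : Proposes G D S v L b) (hL : L <+: L') : Proposes G D S v L' b := by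
  obtain ⟨hr, b₀, hb⟩ := h
  rw [← before_eq_of_prefix hr hL] at hb
  exact ⟨hr.mono hL, b₀, hb⟩

/-- Here `L'` may be shorter than `L`; it only has to be past the acknowledgement deadline. Safety
compares ledgers taken from unrelated views, so consistency is the appropriate hypothesis. -/
theorem Acks.of_consistent {S : Epoch V X} {v : ℕ} {j : Fin 3} {L L' : VFeed V X} {b : Block X}
    (h : Acks G D S v j L b) (hL : Consistent L L') (hr : Reached D (3 * v + 1) L') :
    Acks G D S v j L' b := by
  refine ⟨hr, ?_⟩
  rw [← before_eq_of_consistent h.1 hr hL]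
  exact h.2

theorem Acks.mono {S : Epoch V X} {v : ℕ} {j : Fin 3} {L L' : VFeed V X} {b : Block X}
    (h : Acks G D S v j L b) (hL : L <+: L') : Acks G D S v j L' b :=
  h.of_consistent (Or.inl hL) (h.1.mono hL)

theorem Certifies.mono {S : Epoch V X} {v : ℕ} {j : Fin 3} {P L : VFeed V X} {b : Block X}
    (h : Certifies G D S v j P b) (hP : P <+: L) : Certifies G D S v j L b := by
  obtain ⟨i₁, i₂, M₁, M₂, hne, k₁, a₁, k₂, a₂⟩ := h
  obtain ⟨M₁', p₁, k₁⟩ := k₁.mono hP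
  obtain ⟨M₂', p₂, k₂⟩ := k₂.mono hP
  exact ⟨i₁, i₂, M₁', M₂', hne, k₁, a₁.mono p₁, k₂, a₂.mono p₂⟩

theorem Certifies.read {S : Epoch V X} {v : ℕ} {i j : Fin 3} {P : VFeed V X} {b : Block X}
    {W : V} {τ : ℕ} {x : Option X} (h : Certifies G D S v i (G i W) b)
    (hP : (τ, some (x, some W)) ∈ P) : Certifies G D S v j P b := by
  obtain ⟨i₁, i₂, M₁, M₂, hne, k₁, a₁, k₂, a₂⟩ := h
  exact ⟨i₁, i₂, M₁, M₂, hne, .read _ _ τ x W i _ _ hP k₁, a₁, .read _ _ τ x W i _ _ hP k₂, a₂⟩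

@[simp] theorem epoch_append_singleton (b : Block X) (v : ℕ) (d : List X) :
    Block.epoch (b ++ [(v, d)]) = v := by
  simp [Block.epoch]

theorem epoch_le_of_forall {b : Block X} {v : ℕ} (h : ∀ p ∈ b, p.1 ≤ v) : Block.epoch b ≤ v := by
  unfold Block.epoch
  cases hl : b.getLast? with
  | none => simp
  | some p => simpa using h p (List.mem_of_getLast? hl)

theorem Proposes.epoch_eq {S : Epoch V X} {v : ℕ} {L : VFeed V X} {b : Block X}
    (h : Proposes G D S v L b) : Block.epoch b = v := by
  obtain ⟨-, b₀, -, rfl⟩ := h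
  simp

theorem Acks.exists_proposes {S : Epoch V X} {v : ℕ} {j : Fin 3} {L : VFeed V X} {b : Block X}
    (h : Acks G D S v j L b) : ∃ M, Proposes G D S v M b :=
  h.2.imp fun _ h => h.2

theorem Certifies.exists_proposes {S : Epoch V X} {v : ℕ} {j : Fin 3} {P : VFeed V X}
    {b : Block X} (h : Certifies G D S v j P b) : ∃ M, Proposes G D S v M b := by
  obtain ⟨i₁, i₂, M₁, M₂, hne, k₁, a₁, k₂, a₂⟩ := h
  exact a₁.exists_proposes

/-- The maximal block in a set of observed leader-down messages exists. -/
theorem exists_maxDown {S : Epoch V X} {j : Fin 3} {P : VFeed V X} {N : ℕ}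
    (hN : ∀ i M, Block.epoch (S.high i M) ≤ N) (h : TwoDowns G S j P) : ∃ b, MaxDown G S j P b := by
  classical
  obtain ⟨i₁, -, M₁, -, -, hk, hd, -⟩ := h
  let p : ℕ → Prop := fun n => ∃ i M, Knows G j P i M ∧ S.Down i M ∧ Block.epoch (S.high i M) = n
  have hp : p (Block.epoch (S.high i₁ M₁)) := ⟨i₁, M₁, hk, hd, rfl⟩
  obtain ⟨i, M, hk', hd', he⟩ := Nat.findGreatest_spec (P := p) (hN i₁ M₁) hp
  refine ⟨S.high i M, ⟨i, M, hk', hd', rfl⟩, fun i' M' hk'' hd'' => ?_⟩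
  rw [he]
  exact Nat.le_findGreatest (hN i' M') ⟨i', M', hk'', hd'', rfl⟩

/-- The two sources of the parent block of a proposal. -/
theorem parent_cases {S : Epoch V X} {j : Fin 3} {P : VFeed V X} {N : ℕ} {b : Block X}
    (hN : ∀ i M, Block.epoch (S.high i M) ≤ N) (h : parent G S j P = some b) :
    S.Cert j P b ∨ TwoDowns G S j P ∧ MaxDown G S j P b := by
  unfold parent at h
  split_ifs at h with hc hd
  · simp only [Option.some.injEq] at h
    rw [← h]
    exact Or.inl (Classical.epsilon_spec hc)
  · simp only [Option.some.injEq] at h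
    rw [← h]
    exact Or.inr ⟨hd, Classical.epsilon_spec (exists_maxDown hN hd)⟩

theorem exists_parent_of {S : Epoch V X} {j : Fin 3} {P : VFeed V X}
    (h : (∃ b, S.Cert j P b) ∨ TwoDowns G S j P) : ∃ b, parent G S j P = some b := by
  unfold parent
  split_ifs with hc hd
  · exact ⟨_, rfl⟩
  · exact ⟨_, rfl⟩
  · exact absurd h (by tauto)

theorem high_succ_of_acks {v : ℕ} {j : Fin 3} {L : VFeed V X}
    (h : ∃ b, Acks G D (epoch G D v) (v + 1) j L b) :
    Acks G D (epoch G D v) (v + 1) j L ((epoch G D (v + 1)).high j L) := by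
  have : (epoch G D (v + 1)).high j L =
      Classical.epsilon fun b => Acks G D (epoch G D v) (v + 1) j L b := if_pos h
  rw [this]
  exact Classical.epsilon_spec h

theorem high_succ_of_not {v : ℕ} {j : Fin 3} {L : VFeed V X}
    (h : ¬∃ b, Acks G D (epoch G D v) (v + 1) j L b) :
    (epoch G D (v + 1)).high j L = (epoch G D v).high j L := if_neg h

/-- Certified blocks and the blocks in leader-down messages have no epochs beyond the current
one. -/
theorem epochs_le (v : ℕ) :
    (∀ j P b, (epoch G D v).Cert j P b → ∀ p ∈ b, p.1 ≤ v) ∧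
      ∀ j L, ∀ p ∈ (epoch G D v).high j L, p.1 ≤ v := by
  induction v with
  | zero =>
    constructor
    · intro j P b hb
      have : b = [] := hb
      simp [this]
    · intro j L p hp
      have : p ∈ ([] : Block X) := hp
      simp at this
  | succ v ih =>
    -- The parent of a proposal is a certified block or one carried by a leader-down message, so
    -- both halves of the claim feed each other in the induction.
    have key : ∀ M b, Proposes G D (epoch G D v) (v + 1) M b → ∀ p ∈ b, p.1 ≤ v + 1 := by
      rintro M b ⟨-, b₀, hb₀, rfl⟩ p hp
      rcases List.mem_append.1 hp with hp | hp
      · rcases parent_cases (fun i M => epoch_le_of_forall (ih.2 i M)) hb₀ with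
          h | ⟨-, ⟨i, M, -, -, h⟩, -⟩
        · exact (ih.1 _ _ _ h p hp).trans (Nat.le_succ v)
        · rw [← h] at hp
          exact (ih.2 _ _ p hp).trans (Nat.le_succ v)
      · simp only [List.mem_singleton] at hp
        simp [hp]
    constructor
    · intro j P b hb
      obtain ⟨M, hM⟩ := Certifies.exists_proposes (show Certifies G D _ _ j P b from hb)
      exact key M b hM
    · intro j L p hp
      by_cases h : ∃ b, Acks G D (epoch G D v) (v + 1) j L b
      · obtain ⟨M, hM⟩ := (high_succ_of_acks h).exists_proposes
        exact key M _ hM p hp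
      · rw [high_succ_of_not h] at hp
        exact (ih.2 j L p hp).trans (Nat.le_succ v)

theorem epoch_high_le (v : ℕ) (j : Fin 3) (L : VFeed V X) :
    Block.epoch ((epoch G D v).high j L) ≤ v :=
  epoch_le_of_forall ((epochs_le v).2 j L)

theorem epoch_of_cert {v : ℕ} {j : Fin 3} {P : VFeed V X} {b : Block X}
    (h : (epoch G D v).Cert j P b) : Block.epoch b = v := by
  cases v with
  | zero =>
    have : b = [] := h
    simp [this, Block.epoch]
  | succ v =>
    obtain ⟨M, hM⟩ := Certifies.exists_proposes (show Certifies G D _ _ j P b from h)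
    exact hM.epoch_eq

theorem Accepted.epochs_le {W : V} {b : Block X} (h : Accepted G D W b) :
    ∀ p ∈ b, p.1 ≤ Block.epoch b := by
  obtain ⟨v, i₁, i₂, -, hc, -⟩ := h
  rw [epoch_of_cert hc]
  exact (OFT.epochs_le v).1 _ _ _ hc

theorem mem_inputs {P : VFeed V X} {x : X} :
    x ∈ inputs P ↔ ∃ τ o, (τ, some (some x, o)) ∈ P := by
  simp only [inputs, List.mem_filterMap]
  constructor
  · rintro ⟨⟨τ, e⟩, he, h⟩
    rcases e with _ | ⟨a, o⟩
    · simp at h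
    · simp only [Option.bind_some] at h
      exact ⟨τ, o, by rw [← h]; exact he⟩
  · rintro ⟨τ, o, h⟩
    exact ⟨_, h, by simp⟩

theorem mem_outstanding {P : VFeed V X} {b : Block X} {x : X} :
    x ∈ outstanding b P ↔ x ∈ inputs P ∧ x ∉ b.flatMap Prod.snd := by
  simp [outstanding, mem_clean]

/-- A proposed block contains all inputs observed by the leader. -/
theorem Proposes.exists_mem {S : Epoch V X} {v : ℕ} {L : VFeed V X} {b : Block X} {x : X}
    (h : Proposes G D S v L b) (hx : x ∈ inputs (before D (3 * v) L)) : ∃ p ∈ b, x ∈ p.2 := by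
  obtain ⟨-, b₀, -, rfl⟩ := h
  by_cases hb : x ∈ b₀.flatMap Prod.snd
  · obtain ⟨p, hp, hxp⟩ := List.mem_flatMap.1 hb
    exact ⟨p, List.mem_append_left _ hp, hxp⟩
  · exact ⟨_, List.mem_append_right _ (List.mem_singleton_self _), mem_outstanding.2 ⟨hx, hb⟩⟩

theorem Proposes.mem_last {S : Epoch V X} {v : ℕ} {L : VFeed V X} {b : Block X}
    (h : Proposes G D S v L b) : ∃ p ∈ b, p.1 = v := by
  obtain ⟨-, b₀, -, rfl⟩ := h
  exact ⟨_, List.mem_append_right _ (List.mem_singleton_self _), rfl⟩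

end Basic

/-! ### Liveness -/

section Liveness

variable {V X : Type} {G : Fin 3 → V → VFeed V X} {D K GST : ℕ} {w : ℕ → V}

/-- In the sequence `w` of views, validator `i` makes progress, and the views are recorded by it,
both with latency `K` after `GST`. -/
structure LiveValidator (G : Fin 3 → V → VFeed V X) (K GST : ℕ) (w : ℕ → V) (i : Fin 3) :
    Prop where
  progress : ∀ t, GST + K ≤ t → ∃ e ∈ G i (w t), t ≤ e.1 + K
  reads : ∀ t t', GST ≤ t → t + K ≤ t' →
    ∃ e ∈ (G i (w t')).takeWhile (fun e => decide (e.1 ≤ t + K)), ∃ x, e.2 = some (x, some (w t))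

/-- Turns a latency bound on timestamps into a deadline that is met. -/
theorem mem_before_of_mem_takeWhile {L : VFeed V X} {a n : ℕ} (ha : a < n * D)
    {e : ℕ × Option (Option X × Option V)}
    (he : e ∈ L.takeWhile (fun e => decide (e.1 ≤ a))) : e ∈ before D n L := by
  refine mem_takeWhile_mono (fun y hy => ?_) he
  simp only [decide_eq_true_eq] at hy ⊢
  omega

theorem LiveValidator.reads_before {i : Fin 3} (h : LiveValidator G K GST w i) {t t' n : ℕ}
    (ht : GST ≤ t) (ht' : t + K ≤ t') (hn : t + K < n * D) :
    ∃ τ x, (τ, some (x, some (w t))) ∈ before D n (G i (w t')) := by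
  obtain ⟨⟨τ, e⟩, he, x, hx⟩ := h.reads t t' ht ht'
  simp only at hx
  subst hx
  exact ⟨τ, x, mem_before_of_mem_takeWhile hn he⟩

theorem LiveValidator.reached {i : Fin 3} (h : LiveValidator G K GST w i) {t n : ℕ}
    (ht : GST + K ≤ t) (hn : n * D + K ≤ t) : Reached D n (G i (w t)) := by
  obtain ⟨e, he, hte⟩ := h.progress t ht
  exact ⟨e, he, by omega⟩

/-- After GST, a live leader has a ticket if there is another live validator. -/
theorem exists_parent {j j' : Fin 3} (hj : LiveValidator G K GST w j)
    (hj' : LiveValidator G K GST w j') (hne : j ≠ j') (hD : 2 * K < D) {v t : ℕ}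
    (hv : GST ≤ 3 * v * D) (ht : 3 * (v + 1) * D ≤ t) :
    ∃ b, parent G (epoch G D v) j (before D (3 * (v + 1)) (G j (w t))) = some b := by
  apply exists_parent_of
  cases v with
  | zero => exact Or.inl ⟨[], rfl⟩
  | succ u =>
    have e₁ : (3 * (u + 1) + 2) * D = 3 * (u + 1) * D + 2 * D := by ring
    have e₂ : 3 * (u + 1 + 1) * D = 3 * (u + 1) * D + 3 * D := by ring
    -- At time `s` both validators are past the leader-down deadline. The view at `s` is recorded by
    -- `j` within another `K`, hence before the next epoch since `2 * K < D`.
    set s := (3 * (u + 1) + 2) * D + K with hs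
    obtain ⟨τ, x, hr⟩ := hj.reads_before (D := D) (t := s) (t' := t) (n := 3 * (u + 1 + 1))
      (by omega) (by omega) (by omega)
    -- A certificate seen by any validator before the deadline reaches `j` through that view.
    -- Otherwise both live validators send leader-down messages, which reach `j` the same way.
    by_cases h : ∃ i b, Certifies G D (epoch G D u) (u + 1) i
        (before D (3 * (u + 1) + 2) (G i (w s))) b
    · obtain ⟨i, b, hc⟩ := h
      exact Or.inl ⟨b, (hc.mono (before_prefix _ _)).read hr⟩
    · refine Or.inr ⟨j, j', G j (w s), G j' (w s), hne,
        .read _ _ τ x _ j _ _ hr (.self _ _), ⟨?_, ?_⟩,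
        .read _ _ τ x _ j' _ _ hr (.self _ _), ⟨?_, ?_⟩⟩
      · exact hj.reached (by omega) (by omega)
      · exact fun ⟨b, hb⟩ => h ⟨_, b, hb⟩
      · exact hj'.reached (by omega) (by omega)
      · exact fun ⟨b, hb⟩ => h ⟨_, b, hb⟩

/-- After GST, a block of a live leader is accepted if there is another live validator. -/
theorem exists_accepted {j j' : Fin 3} (hj : LiveValidator G K GST w j)
    (hj' : LiveValidator G K GST w j') (hne : j ≠ j') (hD : 2 * K < D) {v : ℕ}
    (hv : GST ≤ 3 * v * D) (hl : leader (v + 1) = j) :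
    ∃ b, Proposes G D (epoch G D v) (v + 1) (G j (w (3 * (v + 1) * D + K))) b ∧
      ∀ t, (3 * (v + 1) + 2) * D ≤ t → Accepted G D (w t) b := by
  have e₀ : 3 * (v + 1) * D = 3 * v * D + 3 * D := by ring
  have e₁ : (3 * (v + 1) + 1) * D = 3 * (v + 1) * D + D := by ring
  have e₂ : (3 * (v + 1) + 2) * D = 3 * (v + 1) * D + 2 * D := by ring
  set s := 3 * (v + 1) * D + K with hs
  obtain ⟨b₀, hb₀⟩ := exists_parent hj hj' hne hD (t := s) hv (by omega)
  have hp : Proposes G D (epoch G D v) (v + 1) (G j (w s))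
      (b₀ ++ [(v + 1, outstanding b₀ (before D (3 * (v + 1)) (G j (w s))))]) :=
    ⟨hj.reached (by omega) (by omega), b₀, by rw [hl]; exact hb₀, rfl⟩
  refine ⟨_, hp, fun t ht => ?_⟩
  set b := b₀ ++ [(v + 1, outstanding b₀ (before D (3 * (v + 1)) (G j (w s))))]
  -- The proposal, visible at `s`, is recorded before the acknowledgement deadline; the
  -- acknowledgements, visible at `s'`, are recorded before time `(3 * (v + 1) + 2) * D`. Both use
  -- `2 * K < D`.
  set s' := (3 * (v + 1) + 1) * D + K with hs'
  have hack : ∀ i, LiveValidator G K GST w i →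
      Acks G D (epoch G D v) (v + 1) i (G i (w s')) b := by
    intro i hi
    obtain ⟨τ, x, hr⟩ := hi.reads_before (D := D) (t := s) (t' := s') (n := 3 * (v + 1) + 1)
      (by omega) (by omega) (by omega)
    refine ⟨hi.reached (by omega) (by omega), G j (w s), ?_, hp⟩
    rw [hl]
    exact .read _ _ τ x _ j _ _ hr (.self _ _)
  have hcert : ∀ i, LiveValidator G K GST w i → (epoch G D (v + 1)).Cert i (G i (w t)) b := by
    intro i hi
    obtain ⟨τ, x, hr⟩ := hi.reads_before (D := D) (t := s') (t' := t) (n := 3 * (v + 1) + 2)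
      (by omega) (by omega) (by omega)
    replace hr := (before_prefix _ _).subset hr
    exact ⟨j, j', _, _, hne, .read _ _ τ x _ j _ _ hr (.self _ _), hack j hj,
      .read _ _ τ x _ j' _ _ hr (.self _ _), hack j' hj'⟩
  exact ⟨v + 1, j, j', hne, hcert j hj, hcert j' hj'⟩

/-- Of any two successive epochs, one is led by one of two given validators. -/
theorem leader_or (j j' : Fin 3) (hne : j ≠ j') (v : ℕ) :
    ∃ u, (u = v ∨ u = v + 1) ∧ (leader u = j ∨ leader u = j') := by
  have h : leader v = j ∨ leader v = j' ∨ leader (v + 1) = j ∨ leader (v + 1) = j' := by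
    have := j.isLt
    have := j'.isLt
    simp only [leader, Fin.ext_iff] at *
    have : (j : ℕ) ≠ j' := fun h => hne (Fin.ext h)
    omega
  rcases h with h | h | h | h
  · exact ⟨v, Or.inl rfl, Or.inl h⟩
  · exact ⟨v, Or.inl rfl, Or.inr h⟩
  · exact ⟨v + 1, Or.inr rfl, Or.inl h⟩
  · exact ⟨v + 1, Or.inr rfl, Or.inr h⟩

/-- Soon after any time `a` after GST, there is an epoch of which all views accept a block that
contains the inputs recorded up to time `a`. -/
theorem exists_accepted_soon {j j' : Fin 3} (hj : LiveValidator G K GST w j)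
    (hj' : LiveValidator G K GST w j') (hne : j ≠ j') (hD : 2 * K < D) {a : ℕ}
    (ha : GST ≤ a) :
    ∃ v b, a ≤ 3 * D * v ∧ 3 * D * v ≤ a + 11 * D ∧ (∃ p ∈ b, p.1 = v) ∧
      Block.epoch b = v ∧ (∀ t, a + 11 * D ≤ t → Accepted G D (w t) b) ∧
      ∀ x, (∀ i, i = j ∨ i = j' → ∀ t, a ≤ t → ∃ e ∈ (G i (w t)).takeWhile
        (fun e => decide (e.1 ≤ a)), ∃ o, e.2 = some (some x, o)) → ∃ p ∈ b, x ∈ p.2 := by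
  have hD' : 0 < 3 * D := by omega
  -- The shift by 2 makes `u` a successor `v + 1` such that already epoch `v` starts after `a`.
  -- Epoch `v + 1` starts by `a + 9 * D`, and acceptance takes `2 * D` more, whence `11 * D`.
  obtain ⟨u, hu, hl⟩ := leader_or j j' hne (a / (3 * D) + 2)
  obtain ⟨v, rfl⟩ : ∃ v, u = v + 1 := by
    generalize a / (3 * D) = q at hu
    exact ⟨u - 1, by omega⟩
  have hdiv := Nat.div_add_mod a (3 * D)
  have hmod := Nat.mod_lt a hD'
  have h1 : 3 * D * (a / (3 * D)) + 3 * D ≤ 3 * D * v := by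
    rw [← Nat.mul_succ]
    exact Nat.mul_le_mul_left _ (by omega)
  have h2 : 3 * D * (v + 1) ≤ 3 * D * (a / (3 * D)) + 9 * D := by
    have : 3 * D * (v + 1) ≤ 3 * D * (a / (3 * D) + 3) := Nat.mul_le_mul_left _ (by omega)
    have e : 3 * D * (a / (3 * D) + 3) = 3 * D * (a / (3 * D)) + 9 * D := by ring
    omega
  have e₁ : 3 * v * D = 3 * D * v := by ring
  have e₂ : 3 * D * (v + 1) = 3 * D * v + 3 * D := by ring
  have e₃ : 3 * (v + 1) * D = 3 * D * v + 3 * D := by ring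
  have e₄ : (3 * (v + 1) + 2) * D = 3 * D * v + 5 * D := by ring
  have key : ∃ b i, (i = j ∨ i = j') ∧
      Proposes G D (epoch G D v) (v + 1) (G i (w (3 * (v + 1) * D + K))) b ∧
      ∀ t, (3 * (v + 1) + 2) * D ≤ t → Accepted G D (w t) b := by
    rcases hl with hl | hl
    · obtain ⟨b, h⟩ := exists_accepted hj hj' hne hD (v := v) (by omega) hl
      exact ⟨b, j, Or.inl rfl, h⟩
    · obtain ⟨b, h⟩ := exists_accepted hj' hj hne.symm hD (v := v) (by omega) hl
      exact ⟨b, j', Or.inr rfl, h⟩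
  obtain ⟨b, i, hi, hp, hacc⟩ := key
  refine ⟨v + 1, b, by omega, by omega, hp.mem_last, hp.epoch_eq,
    fun t ht => hacc t (by omega), fun x hx => hp.exists_mem ?_⟩
  obtain ⟨⟨τ, e⟩, he, o, ho⟩ := hx i hi (3 * (v + 1) * D + K) (by omega)
  simp only at ho
  subst ho
  exact mem_inputs.2 ⟨τ, o, mem_before_of_mem_takeWhile (by omega) he⟩

end Liveness

end OFT

namespace OFT

/-! ### Histories of the validators -/

section History

variable {V X : Type} {G : Fin 3 → V → VFeed V X} {D : ℕ} {S : Set V}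

/-- The set `S` of views contains the views that are recorded in the ledgers of its elements. -/
def ReadClosed (G : Fin 3 → V → VFeed V X) (S : Set V) : Prop :=
  ∀ W ∈ S, ∀ i τ x W', (τ, some (x, some W')) ∈ G i W → W' ∈ S

/-- `M` is an initial part of the ledger of validator `i` in some view in `S`. -/
def InHistory (G : Fin 3 → V → VFeed V X) (S : Set V) (i : Fin 3) (M : VFeed V X) : Prop :=
  ∃ W ∈ S, M <+: G i W

theorem InHistory.of_prefix {i : Fin 3} {M M' : VFeed V X} (h : InHistory G S i M)
    (hM : M' <+: M) : InHistory G S i M' := by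
  obtain ⟨W, hW, h⟩ := h
  exact ⟨W, hW, hM.trans h⟩

/-- Closure under reading keeps nested observations inside `S`, so every action cited in a
certificate or leader-down message belongs to the history of its validator. -/
theorem InHistory.knows (hS : ReadClosed G S) {j i : Fin 3} {P M : VFeed V X}
    (hP : InHistory G S j P) (h : Knows G j P i M) : InHistory G S i M := by
  induction h with
  | self => exact hP
  | read j L τ x W i' i M he _ ih =>
    obtain ⟨W', hW', hL⟩ := hP
    exact ih ⟨W, hS W' hW' j τ x W (hL.subset he), List.prefix_refl _⟩

theorem Acks.exists_inHistory (hS : ReadClosed G S) {E : Epoch V X} {v : ℕ} {j : Fin 3}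
    {L : VFeed V X} {b : Block X} (hL : InHistory G S j L) (h : Acks G D E v j L b) :
    ∃ M, InHistory G S (leader v) M ∧ Proposes G D E v M b := by
  obtain ⟨-, M, hk, hp⟩ := h
  exact ⟨M, (hL.of_prefix (before_prefix _ _)).knows hS hk, hp⟩

theorem Certifies.exists_inHistory (hS : ReadClosed G S) {E : Epoch V X} {v : ℕ} {j : Fin 3}
    {P : VFeed V X} {b : Block X} (hP : InHistory G S j P) (h : Certifies G D E v j P b) :
    ∃ M, InHistory G S (leader v) M ∧ Proposes G D E v M b := by
  obtain ⟨i₁, i₂, M₁, M₂, -, k₁, a₁, -, -⟩ := h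
  exact a₁.exists_inHistory hS (hP.knows hS k₁)

/-- There are finitely many accepted blocks if finitely many views can be observed. -/
theorem finite_accepted (hS : ReadClosed G S) (hfin : S.Finite) (hD : 0 < D) {W : V}
    (hW : W ∈ S) : {b | Accepted G D W b}.Finite := by
  -- With `D` positive, a finite ledger reaches only finitely many epochs; in each, a given ledger
  -- proposes at most one block.
  have hvfin : ∀ W' i, {v : ℕ | Reached D (3 * (v + 1)) (G i W')}.Finite := by
    intro W' i
    refine ((G i W').finite_toSet.biUnion fun e _ => Set.finite_le_nat e.1).subset ?_
    rintro v ⟨e, he, hv⟩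
    simp only [Set.mem_iUnion]
    refine ⟨e, he, ?_⟩
    calc v ≤ 3 * (v + 1) * 1 := by omega
      _ ≤ 3 * (v + 1) * D := Nat.mul_le_mul_left _ hD
      _ ≤ e.1 := hv
  have hb : ∀ W' v, {b | Proposes G D (epoch G D v) (v + 1) (G (leader (v + 1)) W') b}.Finite := by
    intro W' v
    apply Set.Subsingleton.finite
    rintro b ⟨-, b₀, h₀, rfl⟩ b' ⟨-, b₀', h₀', rfl⟩
    rw [h₀] at h₀'
    cases h₀'
    rfl
  have hfin' := (hfin.biUnion fun W' _ => Set.finite_iUnion fun i : Fin 3 =>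
    (hvfin W' i).biUnion fun v _ => hb W' v)
  refine ((Set.finite_singleton ([] : Block X)).union hfin').subset ?_
  rintro b ⟨v, i₁, i₂, -, hc, -⟩
  cases v with
  | zero => exact Or.inl hc
  | succ v =>
    obtain ⟨M, ⟨W', hW', hM⟩, hp⟩ := Certifies.exists_inHistory hS ⟨W, hW, List.prefix_refl _⟩ hc
    refine Or.inr ?_
    simp only [Set.mem_iUnion]
    exact ⟨W', hW', leader (v + 1), v, hp.1.mono hM, hp.mono hM⟩

/-- The data of the blocks are inputs of the validators. -/
theorem data_mem_inputs (hS : ReadClosed G S) (v : ℕ) :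
    (∀ j P b, InHistory G S j P → (epoch G D v).Cert j P b →
      ∀ p ∈ b, ∀ x ∈ p.2, ∃ i, ∃ W ∈ S, x ∈ inputs (G i W)) ∧
      ∀ j L, InHistory G S j L → ∀ p ∈ (epoch G D v).high j L, ∀ x ∈ p.2,
        ∃ i, ∃ W ∈ S, x ∈ inputs (G i W) := by
  induction v with
  | zero =>
    constructor
    · intro j P b _ hb
      have : b = [] := hb
      simp [this]
    · intro j L _ p hp
      have : p ∈ ([] : Block X) := hp
      simp at this
  | succ v ih =>
    have key : ∀ M b, InHistory G S (leader (v + 1)) M →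
        Proposes G D (epoch G D v) (v + 1) M b →
        ∀ p ∈ b, ∀ x ∈ p.2, ∃ i, ∃ W ∈ S, x ∈ inputs (G i W) := by
      rintro M b hM ⟨-, b₀, hb₀, rfl⟩ p hp x hx
      have hP := hM.of_prefix (before_prefix (D := D) (3 * (v + 1)) M)
      rcases List.mem_append.1 hp with hp | hp
      · rcases parent_cases (fun i M => epoch_high_le v i M) hb₀ with
          h | ⟨-, ⟨i, M', hk, -, h⟩, -⟩
        · exact ih.1 _ _ _ hP h p hp x hx
        · rw [← h] at hp
          exact ih.2 _ _ (hP.knows hS hk) p hp x hx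
      · simp only [List.mem_singleton] at hp
        subst hp
        obtain ⟨W, hW, hPW⟩ := hP
        obtain ⟨τ, o, h⟩ := mem_inputs.1 (mem_outstanding.1 hx).1
        exact ⟨_, W, hW, mem_inputs.2 ⟨τ, o, hPW.subset h⟩⟩
    constructor
    · intro j P b hP hb
      obtain ⟨M, hM, hp⟩ := Certifies.exists_inHistory hS hP hb
      exact key M b hM hp
    · intro j L hL p hp
      by_cases h : ∃ b, Acks G D (epoch G D v) (v + 1) j L b
      · obtain ⟨M, hM, hpr⟩ := (high_succ_of_acks h).exists_inHistory hS hL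
        exact key M _ hM hpr p hp
      · rw [high_succ_of_not h] at hp
        exact ih.2 j L hL p hp

/-! ### Safety -/

/-- The ledgers of each validator in the views in `S` are consistent. -/
def ConsistentOn (G : Fin 3 → V → VFeed V X) (S : Set V) : Prop :=
  ∀ i, ∀ W ∈ S, ∀ W' ∈ S, Consistent (G i W) (G i W')

theorem InHistory.consistent (hC : ConsistentOn G S) {i : Fin 3} {M M' : VFeed V X}
    (h : InHistory G S i M) (h' : InHistory G S i M') : Consistent M M' := by
  obtain ⟨W, hW, hM⟩ := h
  obtain ⟨W', hW', hM'⟩ := h'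
  exact (hC i W hW W' hW').of_prefix hM hM'

/-- No equivocation: a proposal is a function of the part of the leader's ledger before the start of
the epoch, and consistent ledgers past that time share this part. -/
theorem Proposes.unique (hC : ConsistentOn G S) {E : Epoch V X} {v : ℕ} {L L' : VFeed V X}
    {b b' : Block X} (hL : InHistory G S (leader v) L) (hL' : InHistory G S (leader v) L')
    (h : Proposes G D E v L b) (h' : Proposes G D E v L' b') : b = b' := by
  obtain ⟨hr, b₀, hb₀, rfl⟩ := h
  obtain ⟨hr', b₀', hb₀', rfl⟩ := h'
  rw [before_eq_of_consistent hr hr' (hL.consistent hC hL')] at hb₀ ⊢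
  rw [hb₀] at hb₀'
  cases hb₀'
  rfl

/-- A validator that acknowledged a block remembers an epoch at least as high. -/
theorem le_epoch_high {v u : ℕ} {j : Fin 3} {L : VFeed V X} {b : Block X}
    (h : Acks G D (epoch G D v) (v + 1) j L b) (hu : v ≤ u) :
    v + 1 ≤ Block.epoch ((epoch G D (u + 1)).high j L) := by
  have key : ∀ u, (∃ b, Acks G D (epoch G D u) (u + 1) j L b) →
      Block.epoch ((epoch G D (u + 1)).high j L) = u + 1 := by
    intro u hu
    obtain ⟨M, hM⟩ := (high_succ_of_acks hu).exists_proposes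
    exact hM.epoch_eq
  induction u, hu using Nat.le_induction with
  | base => exact (key v ⟨b, h⟩).ge
  | succ u hu ih =>
    by_cases hb : ∃ b, Acks G D (epoch G D (u + 1)) (u + 1 + 1) j L b
    · rw [key (u + 1) hb]
      omega
    · rwa [high_succ_of_not hb]

/-- The remembered block is the genesis block or was acknowledged in its epoch. -/
theorem high_cases (v : ℕ) (j : Fin 3) (L : VFeed V X) :
    (epoch G D v).high j L = [] ∨
      ∃ u < v, Acks G D (epoch G D u) (u + 1) j L ((epoch G D v).high j L) := by
  induction v with
  | zero => exact Or.inl rfl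
  | succ v ih =>
    by_cases hb : ∃ b, Acks G D (epoch G D v) (v + 1) j L b
    · exact Or.inr ⟨v, Nat.lt_succ_self v, high_succ_of_acks hb⟩
    · rw [high_succ_of_not hb]
      exact ih.imp id fun ⟨u, hu, h⟩ => ⟨u, by omega, h⟩

/-- All proposals of later epochs extend a certified block. -/
theorem prefix_of_certified (hS : ReadClosed G S) (hC : ConsistentOn G S) {v : ℕ} {j : Fin 3}
    {P : VFeed V X} {b : Block X} (hP : InHistory G S j P)
    (hb : Certifies G D (epoch G D v) (v + 1) j P b) (u : ℕ) (hu : v ≤ u) {L : VFeed V X}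
    {b' : Block X} (hL : InHistory G S (leader (u + 1)) L)
    (h : Proposes G D (epoch G D u) (u + 1) L b') : b <+: b' := by
  induction u using Nat.strong_induction_on generalizing L b' with
  | _ u ih =>
  rcases hu.eq_or_lt with rfl | hu
  · obtain ⟨M, hM, hp⟩ := hb.exists_inHistory hS hP
    rw [hp.unique hC hM hL h]
  obtain ⟨u, rfl⟩ : ∃ u', u = u' + 1 := ⟨u - 1, by omega⟩
  obtain ⟨-, b₀, hb₀, rfl⟩ := h
  refine List.IsPrefix.trans ?_ (List.prefix_append _ _)
  have hQ := hL.of_prefix (before_prefix (D := D) (3 * (u + 1 + 1)) L)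
  rcases parent_cases (fun i M => epoch_high_le (u + 1) i M) hb₀ with hc | ⟨hd, hm⟩
  · obtain ⟨M, hM, hp⟩ := Certifies.exists_inHistory hS hQ hc
    exact ih u (by omega) (by omega) hM hp
  · obtain ⟨a₁, a₂, A₁, A₂, hne, ka₁, ha₁, ka₂, ha₂⟩ := hb
    obtain ⟨d₁, d₂, M₁, M₂, hne', kd₁, hd₁, kd₂, hd₂⟩ := hd
    -- Quorum intersection: among three validators, some `a` both acknowledged `b` and sent a
    -- leader-down message.
    have key : ∃ a A M, InHistory G S a A ∧ Acks G D (epoch G D v) (v + 1) a A b ∧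
        Knows G (leader (u + 1 + 1)) (before D (3 * (u + 1 + 1)) L) a M ∧
        (epoch G D (u + 1)).Down a M := by
      have hpig : a₁ = d₁ ∨ a₁ = d₂ ∨ a₂ = d₁ ∨ a₂ = d₂ := by omega
      rcases hpig with rfl | rfl | rfl | rfl
      · exact ⟨_, _, _, hP.knows hS ka₁, ha₁, kd₁, hd₁⟩
      · exact ⟨_, _, _, hP.knows hS ka₁, ha₁, kd₂, hd₂⟩
      · exact ⟨_, _, _, hP.knows hS ka₂, ha₂, kd₁, hd₁⟩
      · exact ⟨_, _, _, hP.knows hS ka₂, ha₂, kd₂, hd₂⟩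
    obtain ⟨a, A, M, hA, hack, hk, hdown⟩ := key
    have hM := hQ.knows hS hk
    -- `A` and `M` may come from different views, but `M` is past the leader-down deadline of a
    -- later epoch, so it shows the same acknowledgement. The block sent by `a`, hence the maximal
    -- one, then has epoch at least `v + 1`.
    have hack' := hack.of_consistent (hA.consistent hC hM)
      (Reached.of_le (show Reached D (3 * (u + 1) + 2) M from hdown.1) (by omega))
    have hle := (le_epoch_high hack' (show v ≤ u by omega)).trans (hm.2 a M hk hdown)
    obtain ⟨i, M', hk', -, rfl⟩ := hm.1
    -- The maximal block is not genesis, whose epoch is `0`. It was thus proposed in an epoch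
    -- between that of `b` and the preceding one, where the induction hypothesis applies.
    rcases high_cases (G := G) (D := D) (u + 1) i M' with h | ⟨w, hw, h⟩
    · rw [h] at hle
      simp [Block.epoch] at hle
    · obtain ⟨M'', hM'', hp⟩ := h.exists_inHistory hS (hQ.knows hS hk')
      rw [hp.epoch_eq] at hle
      exact ih w (by omega) (by omega) hM'' hp

/-- Accepted blocks do not conflict. -/
theorem Accepted.consistent (hS : ReadClosed G S) (hC : ConsistentOn G S) {W W' : V}
    (hW : W ∈ S) (hW' : W' ∈ S) {b b' : Block X} (h : Accepted G D W b)
    (h' : Accepted G D W' b') : Consistent b b' := by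
  have aux : ∀ v v' W W' b b' i i', v ≤ v' → W ∈ S → W' ∈ S → (epoch G D v).Cert i (G i W) b →
      (epoch G D v').Cert i' (G i' W') b' → b <+: b' := by
    intro v v' W W' b b' i i' hv hW hW' hc hc'
    cases v with
    | zero =>
      have : b = [] := hc
      rw [this]
      exact List.nil_prefix
    | succ v =>
      obtain ⟨v', rfl⟩ : ∃ u, v' = u + 1 := ⟨v' - 1, by omega⟩
      obtain ⟨M, hM, hp⟩ := Certifies.exists_inHistory hS ⟨W', hW', List.prefix_refl _⟩ hc'
      exact prefix_of_certified hS hC ⟨W, hW, List.prefix_refl _⟩ hc v' (by omega) hM hp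
  obtain ⟨v, i, -, -, hc, -⟩ := h
  obtain ⟨v', i', -, -, hc', -⟩ := h'
  rcases le_total v v' with hv | hv
  · exact Or.inl (aux v v' W W' b b' i i' hv hW hW' hc hc')
  · exact Or.inr (aux v' v W' W b' b i' i hv hW' hW hc' hc)

/-! ### The output -/

/-- Finiteness is what gives the choice in `acceptedList` a witness. -/
theorem acceptedList_spec {W : V} (hfin : {b | Accepted G D W b}.Finite) :
    (∀ b, b ∈ acceptedList G D W ↔ Accepted G D W b) ∧
      (acceptedList G D W).Pairwise (fun b b' => Block.epoch b ≤ Block.epoch b') :=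
  Classical.epsilon_spec (p := fun bs : List (Block X) => (∀ b, b ∈ bs ↔ Accepted G D W b) ∧
    bs.Pairwise (fun b b' => Block.epoch b ≤ Block.epoch b'))
    (exists_sorted_list hfin Block.epoch)

/-- Accepted blocks are pairwise consistent across views, so each output is just the deduplication
of a longest one; how ties in the order of epochs are broken does not matter. -/
theorem output_consistent (hS : ReadClosed G S) (hC : ConsistentOn G S) {W W' : V}
    (hW : W ∈ S) (hW' : W' ∈ S) (hfin : {b | Accepted G D W b}.Finite)
    (hfin' : {b | Accepted G D W' b}.Finite) : Consistent (output G D W) (output G D W') := by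
  refine consistent_sanitize_of_forall
    (fun F => ∃ W ∈ S, ∃ b, Accepted G D W b ∧ F = Block.entries D b) ?_ ?_ ?_
  · rintro _ _ ⟨W, hW, b, hb, rfl⟩ ⟨W', hW', b', hb', rfl⟩
    exact (hb.consistent hS hC hW hW' hb').flatMap _
  · intro F hF
    obtain ⟨b, hb, rfl⟩ := List.mem_map.1 hF
    exact ⟨W, hW, b, ((acceptedList_spec hfin).1 b).1 hb, rfl⟩
  · intro F hF
    obtain ⟨b, hb, rfl⟩ := List.mem_map.1 hF
    exact ⟨W', hW', b, ((acceptedList_spec hfin').1 b).1 hb, rfl⟩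

theorem mem_entries_none {b : Block X} {p : ℕ × List X} (hp : p ∈ b) :
    (3 * D * p.1, none) ∈ Block.entries D b :=
  List.mem_flatMap.2 ⟨p, hp, by simp⟩

theorem mem_entries_some {b : Block X} {p : ℕ × List X} (hp : p ∈ b) {x : X} (hx : x ∈ p.2) :
    (3 * D * p.1, some x) ∈ Block.entries D b :=
  List.mem_flatMap.2 ⟨p, hp, by simp [hx]⟩

theorem exists_of_mem_entries {b : Block X} {e : ℕ × Option X} (he : e ∈ Block.entries D b) :
    ∃ p ∈ b, e.1 = 3 * D * p.1 ∧ ∀ x, e.2 = some x → x ∈ p.2 := by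
  obtain ⟨p, hp, he⟩ := List.mem_flatMap.1 he
  refine ⟨p, hp, ?_⟩
  rcases List.mem_cons.1 he with rfl | he
  · simp
  · obtain ⟨x, hx, rfl⟩ := List.mem_map.1 he
    refine ⟨rfl, fun y hy => ?_⟩
    simp only [Option.some.injEq] at hy
    rwa [← hy]

/-- The entries of an accepted block appear in the output before the entries of later epochs. -/
theorem mem_takeWhile_output {W : V} (hfin : {b | Accepted G D W b}.Finite) {b : Block X}
    (hb : Accepted G D W b) {a : ℕ} (ha : 3 * D * Block.epoch b ≤ a) {e : ℕ × Option X}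
    (he : e ∈ Block.entries D b) :
    e ∈ (output G D W).takeWhile (fun e => decide (e.1 ≤ a)) := by
  obtain ⟨hmem, hsort⟩ := acceptedList_spec hfin
  obtain ⟨l₁, l₂, hl⟩ := List.append_of_mem ((hmem b).2 hb)
  -- The list is cut right after `b`: everything up to there belongs to blocks of no later epoch, so
  -- its timestamps obey the bound.
  have hpre : sanitize ((l₁ ++ [b]).map (Block.entries D)) <+: output G D W := by
    unfold output
    rw [hl]
    exact sanitize_prefix (List.IsPrefix.map _ ⟨l₂, by simp⟩)
  refine mem_takeWhile_of_prefix hpre (fun y hy => ?_)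
    (mem_sanitize.2 ⟨_, List.mem_map.2 ⟨b, by simp, rfl⟩, he⟩)
  obtain ⟨_, hF, hy⟩ := mem_sanitize.1 hy
  obtain ⟨b', hb', rfl⟩ := List.mem_map.1 hF
  obtain ⟨p, hp, hyp, -⟩ := exists_of_mem_entries hy
  have hacc : Accepted G D W b' := (hmem b').1 (by
    rw [hl]
    rcases List.mem_append.1 hb' with h | h
    · exact List.mem_append_left _ h
    · exact List.mem_append_right _ (by simp_all))
  have hle : Block.epoch b' ≤ Block.epoch b := by
    rcases List.mem_append.1 hb' with h | h
    · rw [hl] at hsort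
      exact (List.pairwise_append.1 hsort).2.2 b' h b (by simp)
    · rw [List.mem_singleton.1 h]
  simp only [decide_eq_true_eq]
  rw [hyp]
  exact (Nat.mul_le_mul_left _ ((hacc.epochs_le p hp).trans hle)).trans ha

/-- The payloads in the output are inputs of the validators. -/
theorem output_mem_inputs (hS : ReadClosed G S) {W : V} (hW : W ∈ S)
    (hfin : {b | Accepted G D W b}.Finite) {τ : ℕ} {x : X} (h : (τ, some x) ∈ output G D W) :
    ∃ i, ∃ W' ∈ S, x ∈ inputs (G i W') := by
  obtain ⟨_, hF, hx⟩ := mem_sanitize.1 h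
  obtain ⟨b, hb, rfl⟩ := List.mem_map.1 hF
  obtain ⟨p, hp, -, hxp⟩ := exists_of_mem_entries hx
  obtain ⟨v, i, -, -, hc, -⟩ := ((acceptedList_spec hfin).1 b).1 hb
  exact (data_mem_inputs hS v).1 _ _ _ ⟨W, hW, List.prefix_refl _⟩ hc p hp x (hxp x rfl)

end History

end OFT

/-! ## Recorded messages -/

section Content

variable {k : ℕ} {Tx : Type}

/-- The message `m` is recorded in the view `W` or in a view recorded in it. -/
inductive InContent (m : Msg k Tx) : View k Tx → Prop
  | direct (W : View k Tx) (i : Fin k) (τ : ℕ) : (τ, m) ∈ W i → InContent m W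
  | nested (W : View k Tx) (i : Fin k) (τ : ℕ) (W' : View k Tx) :
      (τ, Msg.snapshot W') ∈ W i → InContent m W' → InContent m W

theorem InContent.trans {m : Msg k Tx} {W W' : View k Tx}
    (h : InContent (Msg.snapshot W') W) (hm : InContent m W') : InContent m W := by
  induction h with
  | direct W i τ h => exact .nested W i τ W' h hm
  | nested W i τ W'' h _ ih => exact .nested W i τ W'' h ih

/-- `Msg` is nested through lists of pairs, so its recursor needs parallel motives for messages,
ledgers and entries. -/
theorem finite_content_of_snapshot (m : Msg k Tx) :
    ∀ W, m = Msg.snapshot W → {m' | InContent m' W}.Finite := by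
  refine Msg.rec (motive_1 := fun m => ∀ W, m = Msg.snapshot W → {m' | InContent m' W}.Finite)
    (motive_2 := fun L => {m' | ∃ e ∈ L, m' = e.2 ∨
      ∃ W, e.2 = Msg.snapshot W ∧ InContent m' W}.Finite)
    (motive_3 := fun e => {m' | m' = e.2 ∨ ∃ W, e.2 = Msg.snapshot W ∧ InContent m' W}.Finite)
    ?_ ?_ ?_ ?_ ?_ ?_ m
  · intro x W h
    cases h
  · intro W ih W' h
    cases h
    refine (Set.finite_iUnion ih).subset ?_
    intro m' hm'
    rw [Set.mem_iUnion]
    rcases hm' with ⟨_, i, τ, h⟩ | ⟨_, i, τ, W', h, hm⟩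
    · exact ⟨i, _, h, Or.inl rfl⟩
    · exact ⟨i, _, h, Or.inr ⟨W', rfl, hm⟩⟩
  · intro W h
    cases h
  · simp
  · intro e L he hL
    refine (he.union hL).subset ?_
    rintro m' ⟨e', he', h⟩
    rcases List.mem_cons.1 he' with rfl | he'
    · exact Or.inl h
    · exact Or.inr ⟨e', he', h⟩
  · intro τ m ih
    by_cases h : ∃ W, m = Msg.snapshot W
    · obtain ⟨W, rfl⟩ := h
      refine ((Set.finite_singleton (Msg.snapshot W)).union (ih W rfl)).subset ?_
      rintro m' (h | ⟨W', h, hm⟩)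
      · exact Or.inl h
      · cases h
        exact Or.inr hm
    · refine (Set.finite_singleton m).subset ?_
      rintro m' (h' | ⟨W', h', -⟩)
      · exact h'
      · exact absurd ⟨W', h'⟩ h

theorem finite_content (W : View k Tx) : {m | InContent m W}.Finite :=
  finite_content_of_snapshot (Msg.snapshot W) W rfl

/-- The view `W` and the views recorded in it. -/
def observable (W : View k Tx) : Set (View k Tx) := {W' | W' = W ∨ InContent (Msg.snapshot W') W}

theorem finite_observable (W : View k Tx) : (observable W).Finite := by
  refine (Set.finite_singleton W).union ?_
  exact (finite_content W).preimage fun W₁ _ W₂ _ h => by simpa using h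

theorem self_mem_observable (W : View k Tx) : W ∈ observable W := Or.inl rfl

theorem InContent.of_observable {m : Msg k Tx} {W W' : View k Tx} (h : W' ∈ observable W)
    (hm : InContent m W') : InContent m W := by
  rcases h with rfl | h
  · exact hm
  · exact h.trans hm

theorem view?_eq_some {m : Msg k Tx} {W : View k Tx} (h : m.view? = some W) :
    m = Msg.snapshot W := by
  cases m <;> simp_all [Msg.view?]

end Content

/-! ## Ledgers of circuits -/

namespace Circuit

variable {k : ℕ} {Tx : Type}

/-- The epochs of all triangular compositions have positive length. -/
def PosEpochs : Circuit k → Prop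
  | .chain _ => True
  | .serial A B => A.PosEpochs ∧ B.PosEpochs
  | .triangular D A B C => 0 < D ∧ A.PosEpochs ∧ B.PosEpochs ∧ C.PosEpochs

/-- The ledger of a validator emulated on the circuit `C`. -/
noncomputable def emulated {X : Type} (read : Msg k Tx → Option X) (C : Circuit k)
    (W : View k Tx) : OFT.VFeed (View k Tx) X :=
  C.run (Option X × Option (View k Tx)) (fun m => some (read m, m.view?)) W

theorem run_triangular {X : Type} (read : Msg k Tx → Option X) (D : ℕ) (A B C : Circuit k)
    (W : View k Tx) : (triangular D A B C).run X read W =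
      OFT.output (fun i => emulated read (![A, B, C] i)) D W := by
  rw [Circuit.run]
  congr 1
  funext i
  fin_cases i <;> rfl

/-- The payloads in the ledger of `C` are read from recorded messages. -/
def ReadsContent (Tx : Type) (C : Circuit k) : Prop :=
  ∀ (X : Type) (read : Msg k Tx → Option X) (W : View k Tx) (τ : ℕ) (y : X),
    (τ, some y) ∈ C.run X read W → ∃ m, InContent m W ∧ read m = some y

theorem ReadsContent.exists_of_emulated {C : Circuit k} (h : C.ReadsContent Tx) {X : Type}
    {read : Msg k Tx → Option X} {W : View k Tx} {τ : ℕ} {x : Option X}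
    {o : Option (View k Tx)} (hm : (τ, some (x, o)) ∈ emulated read C W) :
    ∃ m, InContent m W ∧ read m = x ∧ m.view? = o := by
  obtain ⟨m, hm, he⟩ := h _ _ _ _ _ hm
  simp only [Option.some.injEq, Prod.mk.injEq] at he
  exact ⟨m, hm, he⟩

theorem readClosed_emulated {c : Fin 3 → Circuit k} (hc : ∀ i, (c i).ReadsContent Tx)
    {S : Set (View k Tx)} (hS : ∀ W ∈ S, ∀ W', InContent (Msg.snapshot W') W → W' ∈ S)
    {X : Type} (read : Msg k Tx → Option X) :
    OFT.ReadClosed (fun i => emulated read (c i)) S := by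
  intro W hW i τ x W' h
  obtain ⟨m, hm, -, hv⟩ := (hc i).exists_of_emulated h
  rw [view?_eq_some hv] at hm
  exact hS W hW W' hm

theorem readClosed_observable {c : Fin 3 → Circuit k} (hc : ∀ i, (c i).ReadsContent Tx)
    (W : View k Tx) {X : Type} (read : Msg k Tx → Option X) :
    OFT.ReadClosed (fun i => emulated read (c i)) (observable W) :=
  readClosed_emulated hc (fun _ hW' _ h => Or.inr (h.of_observable hW')) read

theorem finite_accepted_emulated {c : Fin 3 → Circuit k} (hc : ∀ i, (c i).ReadsContent Tx)
    {D : ℕ} (hD : 0 < D) {X : Type} (read : Msg k Tx → Option X) (W : View k Tx) :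
    {b | OFT.Accepted (fun i => emulated read (c i)) D W b}.Finite :=
  OFT.finite_accepted (readClosed_observable hc W read) (finite_observable W) hD
    (self_mem_observable W)

theorem forall_vec {p : Circuit k → Prop} {A B C : Circuit k} (hA : p A) (hB : p B) (hC : p C)
    (i : Fin 3) : p (![A, B, C] i) := by
  fin_cases i
  · exact hA
  · exact hB
  · exact hC

/-- Positive epoch lengths keep the sets of accepted blocks finite, so that triangular outputs
contain only recorded inputs. In a serial composition the payload of `B` comes from a recorded view,
whose content is again recorded. -/
theorem PosEpochs.readsContent {C : Circuit k} (h : C.PosEpochs) : C.ReadsContent Tx := by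
  induction C with
  | chain i =>
    intro X read W τ y hy
    rw [Circuit.run] at hy
    obtain ⟨⟨τ', m⟩, hm, he⟩ := List.mem_map.1 hy
    simp only [Prod.mk.injEq] at he
    exact ⟨m, .direct W i τ' hm, he.2⟩
  | serial A B ihA ihB =>
    intro X read W τ y hy
    rw [Circuit.run] at hy
    obtain ⟨F, hF, hy⟩ := mem_sanitize.1 hy
    obtain ⟨⟨τ', e⟩, he, rfl⟩ := List.mem_filterMap.1 hF
    obtain ⟨m, hm, hr⟩ := ihB h.2 _ _ _ _ _ he
    obtain ⟨W', hW', rfl⟩ := Option.map_eq_some_iff.1 hr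
    obtain ⟨m', hm', hr'⟩ := ihA h.1 _ _ _ _ _ hy
    rw [view?_eq_some hW'] at hm
    exact ⟨m', hm.trans hm', hr'⟩
  | triangular D A B C ihA ihB ihC =>
    intro X read W τ y hy
    rw [run_triangular] at hy
    have hc := forall_vec (p := ReadsContent Tx) (ihA h.2.1) (ihB h.2.2.1) (ihC h.2.2.2)
    obtain ⟨i, W', hW', hx⟩ := OFT.output_mem_inputs (readClosed_observable hc W read)
      (self_mem_observable W) (finite_accepted_emulated hc h.1 read W) hy
    obtain ⟨τ', o, hx⟩ := OFT.mem_inputs.1 hx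
    obtain ⟨m, hm, hr, -⟩ := (hc i).exists_of_emulated hx
    exact ⟨m, hm.of_observable hW', hr⟩

/-! ### Safety -/

/-- All ledgers of the circuit in certified views are consistent. -/
def Safe (C : Circuit k) (R : Trace k Tx) : Prop :=
  ∀ (X : Type) (read : Msg k Tx → Option X) (W W' : View k Tx), (∀ j, W j ∈ R.certified j) →
    (∀ j, W' j ∈ R.certified j) → Consistent (C.run X read W) (C.run X read W')

variable {R : Trace k Tx} {Δ T : ℕ}

/-- Cross-chain reads are verified at every level of nesting, even on chains that are not safe. -/
theorem certified_of_inContent (hR : R.Admissible Δ T) {W W' : View k Tx}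
    (hW : ∀ j, W j ∈ R.certified j) (h : InContent (Msg.snapshot W') W) :
    ∀ j, W' j ∈ R.certified j := by
  induction h with
  | direct W i τ h => exact hR.snapshot_certified i _ (hW i) τ W' h
  | nested W i τ W'' h _ ih => exact ih (hR.snapshot_certified i _ (hW i) τ W'' h)

theorem safe_chain (hR : R.Admissible Δ T) {i : Fin k} (h : R.SafeChain i) :
    (chain i).Safe R := by
  intro X read W W' hW hW'
  rw [Circuit.run, Circuit.run]
  exact (hR.generates_certificates i h _ (hW i) _ (hW' i)).map _

/-- Whatever `B` orders are ledgers of `A` in certified views. These are pairwise consistent, so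
even an unsafe order does no harm. -/
theorem safe_serial_left (hR : R.Admissible Δ T) {A B : Circuit k} (hB : B.PosEpochs)
    (h : A.Safe R) : (serial A B).Safe R := by
  have key : ∀ (X : Type) (read : Msg k Tx → Option X) (W : View k Tx),
      (∀ j, W j ∈ R.certified j) →
      ∀ F ∈ (B.run (Feed X) (fun m => m.view?.map (A.run X read)) W).filterMap Prod.snd,
        ∃ W', (∀ j, W' j ∈ R.certified j) ∧ F = A.run X read W' := by
    intro X read W hW F hF
    obtain ⟨⟨τ, e⟩, he, rfl⟩ := List.mem_filterMap.1 hF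
    obtain ⟨m, hm, hr⟩ := hB.readsContent _ _ _ _ _ he
    obtain ⟨W', hW', rfl⟩ := Option.map_eq_some_iff.1 hr
    rw [view?_eq_some hW'] at hm
    exact ⟨W', certified_of_inContent hR hW hm, rfl⟩
  intro X read W W' hW hW'
  rw [Circuit.run, Circuit.run]
  refine consistent_sanitize_of_forall
    (fun F => ∃ W, (∀ j, W j ∈ R.certified j) ∧ F = A.run X read W) ?_
    (key X read W hW) (key X read W' hW')
  rintro _ _ ⟨W, hW, rfl⟩ ⟨W', hW', rfl⟩
  exact h X read W W' hW hW'

/-- If the sequences of snapshots are consistent, sanitizing them preserves this, even when the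
snapshots themselves conflict. -/
theorem safe_serial_right {A B : Circuit k} (h : B.Safe R) : (serial A B).Safe R := by
  intro X read W W' hW hW'
  rw [Circuit.run, Circuit.run]
  exact ((h _ _ W W' hW hW').filterMap _).sanitize

theorem safe_triangular (hR : R.Admissible Δ T) {D : ℕ} {A B C : Circuit k}
    (h : (triangular D A B C).PosEpochs) (hA : A.Safe R) (hB : B.Safe R) (hC : C.Safe R) :
    (triangular D A B C).Safe R := by
  intro X read W W' hW hW'
  rw [run_triangular, run_triangular]
  have hc := forall_vec (p := ReadsContent Tx) h.2.1.readsContent h.2.2.1.readsContent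
    h.2.2.2.readsContent
  have hs := forall_vec (p := fun C => C.Safe R) hA hB hC
  exact OFT.output_consistent (S := {W : View k Tx | ∀ j, W j ∈ R.certified j})
    (readClosed_emulated hc (fun W hW W' h => certified_of_inContent hR hW h) read)
    (fun i W hW W' hW' => hs i _ _ W W' hW hW') hW hW'
    (finite_accepted_emulated hc h.1 read W) (finite_accepted_emulated hc h.1 read W')

/-- The overlay protocol of a safe circuit is safe. -/
theorem Safe.overlaySafe (hR : R.Admissible Δ T) {C : Circuit k} (h : C.Safe R) :
    R.OverlaySafe (C.overlay (Tx := Tx)) := by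
  constructor
  · intro c c' t t'
    refine consistent_sanitize_of_forall (fun F => ∃ W : View k Tx, (∀ j, W j ∈ R.certified j) ∧
      F = (C.run Tx Msg.tx? W).filterMap Prod.snd) ?_ ?_ ?_
    · rintro _ _ ⟨W, hW, rfl⟩ ⟨W', hW', rfl⟩
      exact (h _ _ W W' hW hW').filterMap _
    all_goals
      intro F hF
      obtain ⟨W, hW, rfl⟩ := List.mem_map.1 hF
      obtain ⟨s, -, rfl⟩ := List.mem_map.1 hW
      exact ⟨_, fun j => hR.ledger_certified j _ s, rfl⟩
  · intro c t t' htt'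
    -- Growth over time needs no safety: the later history extends the earlier one, and sanitization
    -- only appends.
    refine sanitize_prefix (List.IsPrefix.map _ (List.IsPrefix.map _ ?_))
    obtain ⟨d, rfl⟩ := Nat.exists_eq_add_of_le htt'
    rw [show t + d + 1 = t + 1 + d by omega, List.range_add (n := t + 1)]
    exact List.prefix_append _ _

/-! ### Liveness -/

/-- Messages that are input to all chains (up to the network delay) are in the ledgers of the
circuit with latency `K`. -/
def Live (C : Circuit k) (R : Trace k Tx) (Δ K : ℕ) : Prop :=
  ∀ (X : Type) (read : Msg k Tx → Option X) (m : Msg k Tx) (y : X), read m = some y →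
    ∀ t, (∀ i, ∃ s, s ≤ max R.GST t + Δ ∧ m ∈ R.received i s) →
    ∀ c t', max R.GST t + K ≤ t' → ∃ e ∈ C.run X read (R.view c t'), e.2 = some y

/-- The circuit is live, and moreover the timestamps follow the real time up to the latency. -/
structure Timely (C : Circuit k) (R : Trace k Tx) (Δ K : ℕ) : Prop where
  live : ∀ (X : Type) (read : Msg k Tx → Option X) (m : Msg k Tx) (y : X), read m = some y →
    ∀ t, (∀ i, ∃ s, s ≤ max R.GST t + Δ ∧ m ∈ R.received i s) →
    ∀ c t', max R.GST t + K ≤ t' → ∃ e ∈ (C.run X read (R.view c t')).takeWhile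
      (fun e => decide (e.1 ≤ max R.GST t + K)), e.2 = some y
  progress : ∀ (X : Type) (read : Msg k Tx → Option X) c t, R.GST + K ≤ t →
    ∃ e ∈ C.run X read (R.view c t), t ≤ e.1 + K

theorem Timely.toLive {C : Circuit k} {K : ℕ} (h : C.Timely R Δ K) : C.Live R Δ K := by
  intro X read m y hy t hm c t' ht'
  obtain ⟨e, he, hey⟩ := h.live X read m y hy t hm c t' ht'
  exact ⟨e, (List.takeWhile_prefix _).subset he, hey⟩

theorem Timely.mono {C : Circuit k} {K K' : ℕ} (h : C.Timely R Δ K) (hK : K ≤ K') :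
    C.Timely R Δ K' := by
  constructor
  · intro X read m y hy t hm c t' ht'
    obtain ⟨e, he, hey⟩ := h.live X read m y hy t hm c t' (by omega)
    refine ⟨e, mem_takeWhile_mono (fun x hx => ?_) he, hey⟩
    simp only [decide_eq_true_eq] at hx ⊢
    omega
  · intro X read c t ht
    obtain ⟨e, he, hte⟩ := h.progress X read c t (by omega)
    exact ⟨e, he, by omega⟩

/-- `Δ` bounds the delay until the chain receives the message and `T` its own latency. Sorted
timestamps ensure that nothing later precedes the entry. -/
theorem timely_chain (hR : R.Admissible Δ T) {i : Fin k} (h : R.LiveChain T i) :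
    (chain i).Timely R Δ (Δ + T) := by
  constructor
  · intro X read m y hy t hm c t' ht'
    obtain ⟨s, hs, hm⟩ := hm i
    obtain ⟨e, he, rfl, hte⟩ := hR.epochs_timely i h s m hm c t' (by omega)
    obtain ⟨l₁, l₂, hl⟩ := List.append_of_mem he
    have hsort := hR.timestamps_sorted i _ (hR.ledger_certified i c t')
    rw [hl] at hsort
    refine ⟨(e.1, read e.2), ?_, hy⟩
    rw [Circuit.run]
    refine mem_takeWhile_of_prefix
      (P := (l₁ ++ [e]).map fun e => (e.1, read e.2)) (List.IsPrefix.map _ ?_) ?_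
      (List.mem_map.2 ⟨e, by simp, rfl⟩)
    · exact ⟨l₂, by simp [Trace.view, hl]⟩
    · intro x hx
      obtain ⟨e', he', rfl⟩ := List.mem_map.1 hx
      have : e'.1 ≤ e.1 := by
        rcases List.mem_append.1 he' with h | h
        · exact (List.pairwise_append.1 hsort).2.2 e' h e (by simp)
        · rw [List.mem_singleton.1 h]
      simp only [decide_eq_true_eq]
      omega
  · intro X read c t ht
    obtain ⟨e, he, hte⟩ := hR.epochs_progress i h c t (by omega)
    refine ⟨(e.1, read e.2), ?_, by simp only; omega⟩
    rw [Circuit.run]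
    exact List.mem_map.2 ⟨e, he, rfl⟩

theorem exists_received_snapshot (hR : R.Admissible Δ T) (c : R.Client) (t : ℕ) (i : Fin k) :
    ∃ s, s ≤ max R.GST t + Δ ∧ Msg.snapshot (R.view c t) ∈ R.received i s := by
  obtain ⟨s, -, hs, h⟩ := hR.relay c t i
  exact ⟨s, hs, h⟩

/-- The client's own view, taken when `A` has output the payload, is relayed to all chains and
ordered by `B`. Timestamps are not tracked, since serial compositions are never placed inside
triangular ones. -/
theorem live_serial (hR : R.Admissible Δ T) {A B : Circuit k} {KA KB : ℕ}
    (hA : A.Live R Δ KA) (hB : B.Live R Δ KB) : (serial A B).Live R Δ (KA + KB) := by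
  intro X read m y hy t hm c t' ht'
  obtain ⟨e, he, hey⟩ := hA X read m y hy t hm c (max R.GST t + KA) le_rfl
  obtain ⟨f, hf, hfy⟩ := hB (Feed X) (fun m => m.view?.map (A.run X read))
    (Msg.snapshot (R.view c (max R.GST t + KA))) _ rfl (max R.GST t + KA)
    (exists_received_snapshot hR c _) c t' (by omega)
  refine ⟨e, ?_, hey⟩
  rw [Circuit.run]
  exact mem_sanitize.2 ⟨_, List.mem_filterMap.2 ⟨f, hf, hfy⟩, he⟩

/-- Recording a view is liveness for the relayed snapshot, taken as a payload of the emulated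
validator. -/
theorem Timely.liveValidator (hR : R.Admissible Δ T) {C : Circuit k} {K : ℕ}
    (h : C.Timely R Δ K) {X : Type} (read : Msg k Tx → Option X) (c : R.Client)
    {G : Fin 3 → View k Tx → OFT.VFeed (View k Tx) X} {i : Fin 3} (hG : G i = emulated read C) :
    OFT.LiveValidator G K R.GST (R.view c) i := by
  constructor
  · intro t ht
    rw [hG]
    exact h.progress _ _ c t ht
  · intro t t' ht ht'
    rw [hG]
    have hmax : max R.GST t = t := max_eq_right ht
    obtain ⟨e, he, hey⟩ := h.live _ (fun m => some (read m, m.view?))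
      (Msg.snapshot (R.view c t)) _ rfl t (exists_received_snapshot hR c t) c t' (by omega)
    rw [hmax] at he
    exact ⟨e, he, _, hey⟩

theorem timely_triangular (hR : R.Admissible Δ T) {D K : ℕ} {A B C : Circuit k}
    (h : (triangular D A B C).PosEpochs) (hD : 2 * K < D) {j j' : Fin 3} (hne : j ≠ j')
    (hj : (![A, B, C] j).Timely R Δ K) (hj' : (![A, B, C] j').Timely R Δ K) :
    (triangular D A B C).Timely R Δ (K + 11 * D) := by
  have hc := forall_vec (p := ReadsContent Tx) h.2.1.readsContent h.2.2.1.readsContent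
    h.2.2.2.readsContent
  constructor
  · intro X read m y hy t hm c t' ht'
    -- By time `a` the payload is in the ledgers of both live validators, so whichever of them leads
    -- the epoch includes it.
    obtain ⟨v, b, -, hv, -, hbv, hacc, hx⟩ := OFT.exists_accepted_soon
      (hj.liveValidator hR read c (G := fun i => emulated read (![A, B, C] i)) rfl)
      (hj'.liveValidator hR read c rfl) hne hD (a := max R.GST t + K) (by omega)
    obtain ⟨p, hp, hyp⟩ := hx y (by
      intro i hi s hs
      have hi : (![A, B, C] i).Timely R Δ K := by
        rcases hi with rfl | rfl
        · exact hj
        · exact hj'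
      obtain ⟨e, he, hey⟩ := hi.live _ (fun m => some (read m, m.view?)) m _ rfl t hm c s hs
      exact ⟨e, he, m.view?, by rw [hey, hy]⟩)
    refine ⟨_, ?_, (rfl : (3 * D * p.1, some y).2 = some y)⟩
    rw [run_triangular]
    exact OFT.mem_takeWhile_output (finite_accepted_emulated hc h.1 read _)
      (hacc t' (by omega)) (by rw [hbv]; omega) (OFT.mem_entries_some hp hyp)
  · intro X read c t ht
    -- Going back `11 * D` from `t` stays after `GST` and gives a block accepted by time `t`. Its
    -- `none` entry shows the time even if the block carries no data.
    obtain ⟨v, b, hv, -, ⟨p, hp, hpv⟩, hbv, hacc, -⟩ := OFT.exists_accepted_soon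
      (hj.liveValidator hR read c (G := fun i => emulated read (![A, B, C] i)) rfl)
      (hj'.liveValidator hR read c rfl) hne hD (a := t - 11 * D) (by omega)
    refine ⟨(3 * D * p.1, none), ?_, by simp only [hpv]; omega⟩
    rw [run_triangular]
    exact (List.takeWhile_prefix _).subset
      (OFT.mem_takeWhile_output (finite_accepted_emulated hc h.1 read _)
        (hacc t (by omega)) le_rfl (OFT.mem_entries_none hp))

/-- The overlay protocol of a live circuit is live. -/
theorem Live.overlayLive {C : Circuit k} {K : ℕ} (h : C.Live R Δ K) :
    R.OverlayLive (C.overlay (Tx := Tx)) K := by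
  intro x t hx c t' ht'
  obtain ⟨e, he, hex⟩ := h Tx Msg.tx? (Msg.tx x) x rfl t
    (fun i => ⟨t, by omega, hx i⟩) c t' ht'
  refine mem_sanitize.2 ⟨_, List.mem_map.2 ⟨R.view c t', ?_, rfl⟩, ?_⟩
  · exact List.mem_map.2 ⟨t', by simp, rfl⟩
  · exact List.mem_filterMap.2 ⟨e, he, hex⟩

end Circuit

/-! ## Construction of the overlay protocols -/

section Construction

variable {k : ℕ}

/-- If the sets `ind l` for `l` in a list intersect pairwise within `ind s`, then some circuit of
triangular compositions is safe if all chains in `s` are safe, and live if the chains in some `l`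
are live. -/
theorem exists_triangular_circuit (Tx : Type) (Δ T : ℕ) (s : Fin k → Bool)
    (ls : List (Fin k → Bool)) (hls : ls ≠ [])
    (hint : ∀ l ∈ ls, ∀ l' ∈ ls, (ind l ∩ ind l' ∩ ind s).Nonempty) :
    ∃ C : Circuit k, C.PosEpochs ∧
      (∀ R : Trace k Tx, R.Admissible Δ T → (∀ i ∈ ind s, R.SafeChain i) → C.Safe R) ∧
      ∃ K, ∀ l ∈ ls, ∀ R : Trace k Tx, R.Admissible Δ T → (∀ i ∈ ind l, R.LiveChain T i) →
        C.Timely R Δ K := by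
  induction h : ls.length using Nat.strong_induction_on generalizing ls with
  | _ n ih =>
  match ls, hls with
  | [a], _ =>
    obtain ⟨i, ⟨ha, -⟩, hs⟩ := hint a (by simp) a (by simp)
    refine ⟨.chain i, trivial, fun R hR h => Circuit.safe_chain hR (h i hs), Δ + T, ?_⟩
    intro l hl R hR h
    rw [List.mem_singleton.1 hl] at h
    exact Circuit.timely_chain hR (h i ha)
  | [a, b], _ =>
    obtain ⟨i, ⟨ha, hb⟩, hs⟩ := hint a (by simp) b (by simp)
    refine ⟨.chain i, trivial, fun R hR h => Circuit.safe_chain hR (h i hs), Δ + T, ?_⟩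
    intro l hl R hR hlive
    simp only [List.mem_cons, List.not_mem_nil, or_false] at hl
    rcases hl with rfl | rfl
    · exact Circuit.timely_chain hR (hlive i ha)
    · exact Circuit.timely_chain hR (hlive i hb)
  | a :: b :: c :: ls, _ =>
    simp only [List.length_cons] at h
    have sub : ∀ ls', ls' ⊆ a :: b :: c :: ls → ∀ l ∈ ls', ∀ l' ∈ ls',
        (ind l ∩ ind l' ∩ ind s).Nonempty :=
      fun ls' h' l hl l' hl' => hint l (h' hl) l' (h' hl')
    -- `A`, `B` and `C` omit `a`, `b` and `c` respectively, so each element of the list is kept by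
    -- at least two of them.
    obtain ⟨A, pA, sA, KA, tA⟩ := ih (ls.length + 2) (by omega) (b :: c :: ls) (by simp)
      (sub _ (by intro x; simp; tauto)) (by simp)
    obtain ⟨B, pB, sB, KB, tB⟩ := ih (ls.length + 2) (by omega) (a :: c :: ls) (by simp)
      (sub _ (by intro x; simp; tauto)) (by simp)
    obtain ⟨C, pC, sC, KC, tC⟩ := ih (ls.length + 2) (by omega) (a :: b :: ls) (by simp)
      (sub _ (by intro x; simp; tauto)) (by simp)
    set K := KA + KB + KC with hK
    -- `2 * K + 1` is the least epoch parameter exceeding `2 * K`; the sum `K` serves as a common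
    -- latency.
    have hpos : (Circuit.triangular (2 * K + 1) A B C).PosEpochs := ⟨by omega, pA, pB, pC⟩
    refine ⟨.triangular (2 * K + 1) A B C, hpos, fun R hR h =>
      Circuit.safe_triangular hR hpos (sA R hR h) (sB R hR h) (sC R hR h),
      K + 11 * (2 * K + 1), fun l hl R hR h => ?_⟩
    have uA : l ∈ b :: c :: ls → (![A, B, C] 0).Timely R Δ K :=
      fun hl => (tA l hl R hR h).mono (by omega)
    have uB : l ∈ a :: c :: ls → (![A, B, C] 1).Timely R Δ K :=
      fun hl => (tB l hl R hR h).mono (by omega)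
    have uC : l ∈ a :: b :: ls → (![A, B, C] 2).Timely R Δ K :=
      fun hl => (tC l hl R hR h).mono (by omega)
    simp only [List.mem_cons] at hl uA uB uC
    rcases hl with hl | hl | hl | hl
    · exact Circuit.timely_triangular hR hpos (by omega) (j := 1) (j' := 2) (by decide)
        (uB (by tauto)) (uC (by tauto))
    · exact Circuit.timely_triangular hR hpos (by omega) (j := 0) (j' := 2) (by decide)
        (uA (by tauto)) (uC (by tauto))
    · exact Circuit.timely_triangular hR hpos (by omega) (j := 0) (j' := 1) (by decide)
        (uA (by tauto)) (uB (by tauto))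
    · exact Circuit.timely_triangular hR hpos (by omega) (j := 0) (j' := 1) (by decide)
        (uA (by tauto)) (uB (by tauto))

/-- The serial composition of the circuits for all `s` in a list. -/
theorem exists_circuit (Tx : Type) (Δ T : ℕ) (ss ls : List (Fin k → Bool)) (hss : ss ≠ [])
    (hls : ls ≠ [])
    (hint : ∀ l ∈ ls, ∀ l' ∈ ls, ∀ s ∈ ss, (ind l ∩ ind l' ∩ ind s).Nonempty) :
    ∃ C : Circuit k, C.PosEpochs ∧
      (∀ s ∈ ss, ∀ R : Trace k Tx, R.Admissible Δ T → (∀ i ∈ ind s, R.SafeChain i) →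
        C.Safe R) ∧
      ∃ K, ∀ l ∈ ls, ∀ R : Trace k Tx, R.Admissible Δ T → (∀ i ∈ ind l, R.LiveChain T i) →
        C.Live R Δ K := by
  induction ss with
  | nil => exact absurd rfl hss
  | cons s ss ih =>
    obtain ⟨A, pA, sA, KA, tA⟩ := exists_triangular_circuit Tx Δ T s ls hls
      fun l hl l' hl' => hint l hl l' hl' s (by simp)
    rcases eq_or_ne ss [] with rfl | hss'
    · refine ⟨A, pA, fun s' hs' => ?_, KA, fun l hl R hR h => (tA l hl R hR h).toLive⟩
      rw [List.mem_singleton.1 hs']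
      exact sA
    · obtain ⟨B, pB, sB, KB, tB⟩ := ih hss'
        fun l hl l' hl' s' hs' => hint l hl l' hl' s' (by simp [hs'])
      refine ⟨.serial A B, ⟨pA, pB⟩, fun s' hs' R hR h => ?_, KA + KB, fun l hl R hR h =>
        Circuit.live_serial hR (tA l hl R hR h).toLive (tB l hl R hR h)⟩
      rcases List.mem_cons.1 hs' with rfl | hs'
      · exact Circuit.safe_serial_left hR pB (sA R hR h)
      · exact Circuit.safe_serial_right (sB s' hs' R hR h)

/-! ### Degenerate cases and passage to minimal elements. -/

/-- The overlay protocol that outputs all transactions on the underlay chains. -/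
def unionOverlay (k : ℕ) (Tx : Type) : Overlay k Tx := fun history =>
  history.getLast?.elim [] fun W => (List.finRange k).flatMap fun i =>
    (W i).filterMap fun e => e.2.tx?

theorem unionOverlay_live {Tx : Type} {T : ℕ} {R : Trace k Tx} {i : Fin k}
    (h : R.LiveChain T i) : R.OverlayLive (unionOverlay k Tx) T := by
  intro x t hx c t' ht'
  obtain ⟨e, he, hex⟩ := h t _ (hx i) c t' ht'
  simp only [Trace.overlayLedger, unionOverlay, List.range_succ, List.map_append, List.map_cons,
    List.map_nil, List.getLast?_append, List.getLast?_singleton, Option.some_or, Option.elim_some]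
  exact List.mem_flatMap.2 ⟨i, List.mem_finRange i, List.mem_filterMap.2
    ⟨e, he, by rw [hex]; rfl⟩⟩

/-- The order on guarantees is finite, hence well-founded, so each element of `V` lies above a
minimal one. -/
theorem upperClosure_subset_exm {E V : Set (Guarantee k)} (h : E ⊆ V) :
    (upperClosure E : Set (Guarantee k)) ⊆ upperClosure (exm V) := by
  intro x hx
  obtain ⟨e, he, hex⟩ := mem_upperClosure.1 hx
  obtain ⟨b, hbe, hb⟩ := exists_minimal_le_of_wellFoundedLT (fun v => v ∈ V) e (h he)
  exact mem_upperClosure.2 ⟨b, ⟨hb.prop, fun ⟨w, hw, hlt⟩ => hb.not_lt hw hlt⟩, hbe.trans hex⟩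

theorem exists_characterized {Tx : Type} {Δ T : ℕ} {P : Overlay k Tx}
    {ES EL : Set (Guarantee k)} (hS : ES ⊆ safetySet Δ T P) (hL : EL ⊆ livenessSet Δ T P) :
    ∃ FS FL, CharacterizedBy Δ T P FS FL ∧ Dominates FS FL ES EL :=
  ⟨_, _, ⟨rfl, rfl⟩, upperClosure_subset_exm hS, upperClosure_subset_exm hL⟩

end Construction

end Interchain

open Interchain in
theorem mainTheorem6 {k : ℕ} {Tx : Type} (Δ T : ℕ) (ES EL : Set (Interchain.Guarantee k))
    (h₁ : ∀ p ∈ EL, ∀ q ∈ ES, p.1 = ⊥ ∧ q.2 = ⊥)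
    (h₂ : ∀ l₁ l₂ s, (⊥, l₁) ∈ EL → (⊥, l₂) ∈ EL → (s, ⊥) ∈ ES →
      (Interchain.ind l₁ ∩ Interchain.ind l₂ ∩ Interchain.ind s).Nonempty)
    (hne : ES.Nonempty ∨ ∀ p ∈ EL, p.2 ≠ ⊥) :
    ∃ (P : Interchain.Overlay k Tx) (FS FL : Set (Interchain.Guarantee k)),
      Interchain.CharacterizedBy Δ T P FS FL ∧
      Interchain.Dominates FS FL ES EL ∧
      (ES.Nonempty → EL.Nonempty → ∃ C : Interchain.Circuit k, P = C.overlay) := by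
  rcases ES.eq_empty_or_nonempty with rfl | hES
  · have hne := hne.resolve_left Set.not_nonempty_empty
    obtain ⟨FS, FL, hc, hd⟩ := exists_characterized (Tx := Tx) (Δ := Δ) (T := T)
      (P := unionOverlay k Tx) (ES := ∅) (EL := EL) (Set.empty_subset _) (by
        intro p hp
        refine ⟨T, fun R _ hm => ?_⟩
        obtain ⟨i, hi⟩ : ∃ i, p.2 i = true := by
          by_contra hcon
          exact hne p hp (funext fun i => by simpa using not_exists.1 hcon i)
        exact unionOverlay_live (hm.2 i hi))
    exact ⟨_, FS, FL, hc, hd, fun h => absurd h Set.not_nonempty_empty⟩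
  rcases EL.eq_empty_or_nonempty with rfl | hEL
  -- Without liveness demands, the empty ledger is safe in every run.
  · obtain ⟨FS, FL, hc, hd⟩ := exists_characterized (Tx := Tx) (Δ := Δ) (T := T)
      (P := fun _ => []) (ES := ES) (EL := ∅)
      (fun p _ R _ _ => ⟨fun _ _ _ _ => Consistent.refl [], fun _ _ _ _ => List.prefix_refl []⟩)
      (Set.empty_subset _)
    exact ⟨_, FS, FL, hc, hd, fun _ h => absurd h Set.not_nonempty_empty⟩
  obtain ⟨p₀, hp₀⟩ := hEL
  obtain ⟨q₀, hq₀⟩ := hES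
  -- `h₁` speaks of pairs, so a vanishing component on one side needs a witness from the other;
  -- hence the separate treatment of the empty cases.
  have eqL : ∀ p ∈ EL, (⊥, p.2) = p := fun p hp => Prod.ext (h₁ p hp q₀ hq₀).1.symm rfl
  have eqS : ∀ q ∈ ES, (q.1, ⊥) = q := fun q hq => Prod.ext rfl (h₁ p₀ hp₀ q hq).2.symm
  have fS : {s | ((s, ⊥) : Guarantee k) ∈ ES}.Finite := Set.toFinite _
  have fL : {l | ((⊥, l) : Guarantee k) ∈ EL}.Finite := Set.toFinite _
  have mS : ∀ s, s ∈ fS.toFinset.toList ↔ ((s, ⊥) : Guarantee k) ∈ ES := by simp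
  have mL : ∀ l, l ∈ fL.toFinset.toList ↔ ((⊥, l) : Guarantee k) ∈ EL := by simp
  obtain ⟨C, -, hsafe, K, hlive⟩ := exists_circuit Tx Δ T fS.toFinset.toList fL.toFinset.toList
    (List.ne_nil_of_mem ((mS q₀.1).2 (by rwa [eqS q₀ hq₀])))
    (List.ne_nil_of_mem ((mL p₀.2).2 (by rwa [eqL p₀ hp₀])))
    (fun l hl l' hl' s hs => h₂ l l' s ((mL l).1 hl) ((mL l').1 hl') ((mS s).1 hs))
  obtain ⟨FS, FL, hc, hd⟩ := exists_characterized (Tx := Tx) (Δ := Δ) (T := T)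
    (P := C.overlay) (ES := ES) (EL := EL)
    (fun q hq R hR hm => (hsafe q.1 ((mS q.1).2 (by rwa [eqS q hq])) R hR hm.1).overlaySafe hR)
    (fun p hp => ⟨K, fun R hR hm =>
      (hlive p.2 ((mL p.2).2 (by rwa [eqL p hp])) R hR hm.2).overlayLive⟩)
  exact ⟨_, FS, FL, hc, hd, fun _ _ => ⟨C, rfl⟩⟩
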